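/- Let $\chi$ be a set, $k$ an integer and $\gamma$ an integer with $1\le\gamma\le k-1$. Let $d_H:\chi^k\to[0,\infty)$ be an $H$-metric with parameter $\gamma$, that is: $d_H$ is invariant under permutations of its arguments; $d_H(p_1,\dots,p_k)=0$ if and only if $p_1=\dots=p_k$; for all $p_1,\dots,p_k,a\in\chi$ and $1\le i\le k$, $$d_H(p_1,\dots,p_k)\le d_H(p_1,\dots,p_i,\underbrace{a,\dots,a}_{k-i})+d_H(\underbrace{a,\dots,a}_{i},p_{i+1},\dots,p_k);$$ and $d_H(p_1,\dots,p_k)\le d_H(p'_1,\dots,p'_k)$ whenever $\{p_1,\dots,p_k\}\subsetneq\{p'_1,\dots,p'_k\}$, while $d_H(p_1,\dots,p_k)\le\gamma\, d_H(p'_1,\dots,p'_k)$ whenever $\{p_1,\dots,p_k\}=\{p'_1,\dots,p'_k\}$ (as sets of distinct elements). **The problem ($k$-MPMD).** An instance $\sigma$ consists of $m$ requests $u_1,\dots,u_m$, where $m$ is a multiple of $k$, with arrival times $0\le\mathrm{atime}(u_1)\le\dots\le\mathrm{atime}(u_m)$ and positions $\mathrm{pos}(u_i)\in\chi$; the requests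 are revealed one by one at their arrival times. All the requests have to be partitioned into groups of size $k$. A group $\{v_1,\dots,v_k\}$ can be matched at any time $\tau\ge\max_i\mathrm{atime}(v_i)$, at the cost $d_H(\mathrm{pos}(v_1),\dots,\mathrm{pos}(v_k))+\sum_{i=1}^k(\tau-\mathrm{atime}(v_i))$. Let $\mathcal{OPT}(\sigma)$ be the infimum of the total cost over all offline solutions. **The algorithm (GD-$k$).** For $p,q\in\chi$ put $d(p,q)=d_H(p,q,\dots,q)+d_H(q,p,\dots,p)$, and for requests $u\ne v$ put $\text{opt-cost}(u,v)=d(\mathrm{pos}(u),\mathrm{pos}(v))+|\mathrm{atime}(u)-\mathrm{atime}(v)|$. The algorithm maintains a partition of the arrived requests into active sets, where $A(v)$ denotes the active set that contains $v$, a number $y_S\ge0$ for each set $S$ of arrived requests, and a family of matched groups; a request in no matched group is called free. - When a request $v$ arrives, set $A(v)=\{v\}$ and $y_S=0$ for all $S\ni v$. - As long as there are arrived requests $u,v$ with $A(u)\ne A(v)$ and $\sum_S y_S=\frac{1}{\gamma k^2}\,\text{opt-cost}(u,v)$, where the sum is over the sets $S$ that contain exactly one of $u,v$, pick such a pair, replace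 the active sets $A(u)$ and $A(v)$ by $S=A(u)\cup A(v)$, and, while $S$ contains at least $k$ free requests, match $k$ of them, arbitrarily chosen, at the current time. - Otherwise let time advance, and let $y_S$ grow at the constant rate $r$ for each active set $S$ that contains a free request. **Theorem.** Run GD-$k$ with rate $r=1/(\gamma k^2)$. Then GD-$k$ is an online algorithm (what it may do up to a time $\tau$ depends only on the requests that have arrived up to time $\tau$). On each instance $\sigma$ with $m$ requests, $k\mid m$, and however the arbitrary choices are made, it comes to an end after finitely many events, it matches all the requests, and the total cost $\mathcal{ALG}(\sigma)$ of its matching satisfies $$\mathcal{ALG}(\sigma)\le(4mk+k^2)\,\gamma\cdot\mathcal{OPT}(\sigma),$$ that is, GD-$k$ is $((4mk+k^2)\gamma)$-competitive. -/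

import Mathlib

noncomputable section

namespace KMPMD

/-! ### H-metrics -/

/-- `d : χ^k → [0,∞)` is an H-metric with parameter `γ ≤ k - 1`. -/
structure IsHMetric {χ : Type*} (k : ℕ) (d : (Fin k → χ) → ℝ) (γ : ℕ) : Prop where
  /-- the parameter is an integer with `γ ≤ k - 1` -/
  param_le : γ + 1 ≤ k
  /-- symmetry: the value does not depend on the order of the `k` points -/
  symm : ∀ (π : Equiv.Perm (Fin k)) (p : Fin k → χ), d (p ∘ π) = d p
  nonneg : ∀ p : Fin k → χ, 0 ≤ d p
  eq_zero_iff : ∀ p : Fin k → χ, d p = 0 ↔ ∀ i j, p i = p j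
  /-- generalized triangle inequality
  `d(p₁,…,p_k) ≤ d(p₁,…,p_i,a,…,a) + d(a,…,a,p_{i+1},…,p_k)` for `1 ≤ i ≤ k` -/
  triangle : ∀ (p : Fin k → χ) (a : χ) (i : ℕ), 1 ≤ i → i ≤ k →
    d p ≤ d (fun j => if (j : ℕ) < i then p j else a)
        + d (fun j => if (j : ℕ) < i then a else p j)
  /-- separation, proper inclusion of the sets of distinct elements -/
  sep_ssubset : ∀ p q : Fin k → χ, Set.range p ⊂ Set.range q → d p ≤ d q
  /-- separation, equality of the sets of distinct elements -/
  sep_eq : ∀ p q : Fin k → χ, Set.range p = Set.range q → d p ≤ (γ : ℝ) * d q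

/-! ### The problem: perfect k-way matching with delays -/

/-- An instance: requests `0, …, m - 1`, listed in order of arrival, with arrival times and
positions.  The values of `atime` and `pos` outside `{0, …, m - 1}` are never used. -/
structure Instance (χ : Type*) where
  m : ℕ
  atime : ℕ → ℝ
  pos : ℕ → χ
  atime_nonneg : ∀ i, i < m → 0 ≤ atime i
  atime_mono : ∀ i j, i ≤ j → j < m → atime i ≤ atime j

/-- A (timed) k-way matching: a finite set of pairs `(F, τ)`, "the group `F` is matched at
time `τ`". -/
abbrev Schedule := Finset (Finset ℕ × ℝ)

variable {χ : Type*} {k : ℕ}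

/-- A perfect k-way matching of all the requests: disjoint groups of size `k` that cover the
requests, each matched not before all its members have arrived. -/
structure Instance.IsPerfect (σ : Instance χ) (k : ℕ) (P : Schedule) : Prop where
  card_eq : ∀ x ∈ P, x.1.card = k
  disjoint : ∀ x ∈ P, ∀ y ∈ P, x ≠ y → Disjoint x.1 y.1
  cover : P.biUnion Prod.fst = Finset.range σ.m
  arrived : ∀ x ∈ P, ∀ v ∈ x.1, σ.atime v ≤ x.2

/-- Distance cost of a group of `k` requests (listed in increasing order; for symmetric `d` the
order is immaterial).  It is only used for groups of size `k`. -/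
def Instance.distCost (σ : Instance χ) (d : (Fin k → χ) → ℝ) (F : Finset ℕ) : ℝ :=
  if h : F.card = k then d (fun i => σ.pos (F.orderEmbOfFin h i)) else 0

/-- Total cost of a timed matching: distance cost plus waiting cost of all the groups. -/
def Instance.cost (σ : Instance χ) (d : (Fin k → χ) → ℝ) (P : Schedule) : ℝ :=
  ∑ x ∈ P, (σ.distCost d x.1 + ∑ v ∈ x.1, (x.2 - σ.atime v))

/-- The offline optimal cost. -/
def Instance.opt (σ : Instance χ) (d : (Fin k → χ) → ℝ) : ℝ :=
  sInf {c : ℝ | ∃ P : Schedule, σ.IsPerfect k P ∧ σ.cost d P = c}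

/-- The instances `σ` and `σ'` cannot be told apart up to and including time `τ`. -/
def Instance.AgreeUpTo (σ σ' : Instance χ) (τ : ℝ) : Prop :=
  ∀ i, ((i < σ.m ∧ σ.atime i ≤ τ) ↔ (i < σ'.m ∧ σ'.atime i ≤ τ)) ∧
    (i < σ.m → σ.atime i ≤ τ → σ'.atime i = σ.atime i ∧ σ'.pos i = σ.pos i)

/-! ### The algorithm GD-k -/

/-- `d(p, q) = d_H(p, q, …, q) + d_H(q, p, …, p)`. -/
def pairDist (d : (Fin k → χ) → ℝ) (p q : χ) : ℝ :=
  d (fun i => if (i : ℕ) = 0 then p else q) + d (fun i => if (i : ℕ) = 0 then q else p)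

/-- `opt-cost(u, v)` of an edge. -/
def Instance.edgeCost (σ : Instance χ) (d : (Fin k → χ) → ℝ) (u v : ℕ) : ℝ :=
  pairDist d (σ.pos u) (σ.pos v) + |σ.atime u - σ.atime v|

/-- A state of the algorithm. -/
structure State where
  /-- the current time -/
  time : ℝ
  /-- the number of requests that have arrived so far, i.e. `0, …, n - 1` -/
  n : ℕ
  /-- the active set `A(v)` of each arrived request `v` -/
  A : ℕ → Finset ℕ
  /-- the dual variables -/
  y : Finset ℕ → ℝ
  /-- the groups matched so far, with the time of matching -/
  matching : Schedule
  /-- the marked edges -/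
  marked : Finset (Sym2 ℕ)

/-- The state before anything has happened. -/
def State.init : State where
  time := 0
  n := 0
  A := fun _ => ∅
  y := fun _ => 0
  matching := ∅
  marked := ∅

/-- The family of active sets. -/
def State.active (s : State) : Finset (Finset ℕ) := (Finset.range s.n).image s.A

/-- The free (not yet matched) requests in `S`. -/
def State.free (s : State) (S : Finset ℕ) : Finset ℕ := S \ s.matching.biUnion Prod.fst

/-- The sum of `y_S` over the sets `S` of arrived requests that are crossed by the edge
`(u, v)`, i.e. contain exactly one of `u` and `v`. -/
def State.load (s : State) (u v : ℕ) : ℝ :=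
  ∑ S ∈ (Finset.range s.n).powerset with ¬ (u ∈ S ↔ v ∈ S), s.y S

/-- `(u, v)` is a tight edge between two different active sets. -/
def State.CrossTight (s : State) (d : (Fin k → χ) → ℝ) (γ : ℕ) (σ : Instance χ)
    (u v : ℕ) : Prop :=
  u < s.n ∧ v < s.n ∧ s.A u ≠ s.A v ∧
    s.load u v = 1 / ((γ : ℝ) * (k : ℝ) ^ 2) * σ.edgeCost d u v

/-- The next request `v = n` arrives: `A(v) = {v}` and `y_S = 0` for all `S ∋ v`. -/
def State.arrive (s : State) : State :=
  { s with
    n := s.n + 1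
    A := fun w => if w = s.n then {s.n} else s.A w
    y := fun S => if s.n ∈ S then 0 else s.y S }

/-- `A(u)` and `A(v)` are merged, the edge `(u, v)` is marked, and the groups in `Q` are matched
at the current time. -/
def State.merge (s : State) (u v : ℕ) (Q : Finset (Finset ℕ)) : State :=
  { s with
    A := fun w => if w ∈ s.A u ∪ s.A v then s.A u ∪ s.A v else s.A w
    matching := s.matching ∪ Q.image (fun F => (F, s.time))
    marked := insert s(u, v) s.marked }

/-- Time advances by `δ`; meanwhile `y_S` grows at rate `r` for each active set `S` that has free
requests. -/
def State.elapse (s : State) (r δ : ℝ) : State :=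
  { s with
    time := s.time + δ
    y := fun S => if S ∈ s.active ∧ (s.free S).Nonempty then s.y S + r * δ else s.y S }

/-- `Q` is a possible choice of groups for the set `X` of free requests: disjoint subsets of `X`
of size `k`, chosen until fewer than `k` requests remain. -/
structure IsGrouping (k : ℕ) (X : Finset ℕ) (Q : Finset (Finset ℕ)) : Prop where
  subset : ∀ F ∈ Q, F ⊆ X
  card_eq : ∀ F ∈ Q, F.card = k
  disjoint : ∀ F ∈ Q, ∀ G ∈ Q, F ≠ G → Disjoint F G
  rest : (X \ Q.biUnion id).card < k

/-- One step of GD-k with rate `r` on the instance `σ`.  All choices that the algorithm may make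
arbitrarily (which tight edge to process first, which free requests to group) are left open.
An `elapse` step lasts until the next event (an arrival, or an edge between two active sets
becoming tight) and no longer. -/
inductive Step (d : (Fin k → χ) → ℝ) (γ : ℕ) (r : ℝ) (σ : Instance χ) : State → State → Prop
  | arrive (s : State) (hn : s.n < σ.m) (ht : σ.atime s.n = s.time) :
      Step d γ r σ s s.arrive
  | merge (s : State) (u v : ℕ) (Q : Finset (Finset ℕ)) (huv : s.CrossTight d γ σ u v)
      (hQ : IsGrouping k (s.free (s.A u ∪ s.A v)) Q) :
      Step d γ r σ s (s.merge u v Q)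
  | elapse (s : State) (δ : ℝ) (hδ : 0 < δ)
      (harr : ∀ i, s.n ≤ i → i < σ.m → s.time + δ ≤ σ.atime i)
      (htight : ∀ ε : ℝ, 0 ≤ ε → ε < δ → ∀ u v, ¬ (s.elapse r ε).CrossTight d γ σ u v)
      (hevent : (s.n < σ.m ∧ σ.atime s.n = s.time + δ) ∨
        ∃ u v, (s.elapse r δ).CrossTight d γ σ u v) :
      Step d γ r σ s (s.elapse r δ)

/-- States that some execution of GD-k on `σ` reaches. -/
def Reachable (d : (Fin k → χ) → ℝ) (γ : ℕ) (r : ℝ) (σ : Instance χ) (s : State) : Prop :=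
  Relation.ReflTransGen (Step d γ r σ) State.init s

/-- Every execution of GD-k on `σ` comes to an end after finitely many steps. -/
def Terminates (d : (Fin k → χ) → ℝ) (γ : ℕ) (r : ℝ) (σ : Instance χ) : Prop :=
  ¬ ∃ run : ℕ → State, run 0 = State.init ∧ ∀ i, Step d γ r σ (run i) (run (i + 1))

/-- `P` is the timed matching returned by some completed execution of GD-k on `σ`. -/
def IsOutput (d : (Fin k → χ) → ℝ) (γ : ℕ) (r : ℝ) (σ : Instance χ) (P : Schedule) : Prop :=
  ∃ s : State, Reachable d γ r σ s ∧ (∀ s', ¬ Step d γ r σ s s') ∧ s.matching = P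

/-- GD-k is online: the states it can be in at times up to `τ` are determined by the requests
that have arrived up to time `τ`. -/
def IsOnline (d : (Fin k → χ) → ℝ) (γ : ℕ) (r : ℝ) : Prop :=
  ∀ (σ σ' : Instance χ) (τ : ℝ), σ.AgreeUpTo σ' τ → ∀ s : State, s.time ≤ τ →
    (Reachable d γ r σ s ↔ Reachable d γ r σ' s)

end KMPMD

end

namespace KMPMD

/-! ### Metric estimates -/

namespace IsHMetric

variable {χ : Type*} {k γ : ℕ} {d : (Fin k → χ) → ℝ}

/-! The argument is primal-dual. The weights $y_S$ stay feasible: the load of an edge never exceeds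
$r=1/(\gamma k^2)$ times its cost, and only sets whose size is not a multiple of $k$ carry weight.
Such a set splits some group of any perfect matching and so crosses at least $k-1$ pairs of that
group, while the scaled costs of all pairs in a group sum to at most the cost of the group. Double
counting gives $(k-1)Y\le\mathcal{OPT}$, where $Y$ is the total weight (`State.Dual.le_cost`).

The cost of the algorithm is charged to $Y$ too. An active set has at most $k-1$ free requests, so
$r$ times the waiting cost grows at most $k-1$ times as fast as $Y$. For distances, let $y(x)$ be
the weight of the sets containing $x$; then $r\,d(x,z)+y(x)+y(z)\le 2\sum_{S\subseteq A}y_S$ for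
$x,z$ in an active set $A$. Growth of $A$ adds the same amount to both sides. A merge along a tight
edge $uv$ uses the triangle inequality through $u$ and $v$, and the spare terms $y(u)+y(v)$ pay for
$uv$. Each group lies in one active set, so a star to a point of that set bounds its distance cost
by $2kY/r$. With $c=m/k$ groups, $r\,\mathcal{ALG}\le(2ck+k-1)Y$ (`State.Dual.cost_le`).

The run is finite by a potential. It cannot stop early: an edge leaving a growing set would
eventually become tight, and a set of all $m$ requests has no free ones because $k\mid m$. -/

theorem two_le (hd : IsHMetric k d γ) (hγ : 0 < γ) : 2 ≤ k := by
  have := hd.param_le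
  omega

theorem const_eq_zero (hd : IsHMetric k d γ) (a : χ) : d (fun _ => a) = 0 :=
  (hd.eq_zero_iff _).2 fun _ _ => rfl

theorem pairDist_nonneg (hd : IsHMetric k d γ) (p q : χ) : 0 ≤ pairDist d p q :=
  add_nonneg (hd.nonneg _) (hd.nonneg _)

theorem pairDist_self (hd : IsHMetric k d γ) (p : χ) : pairDist d p p = 0 := by
  simp [pairDist, hd.const_eq_zero]

theorem pairDist_comm (d : (Fin k → χ) → ℝ) (p q : χ) : pairDist d p q = pairDist d q p :=
  add_comm _ _

theorem single_triangle (hd : IsHMetric k d γ) (p q a : χ) :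
    d (fun i => if (i : ℕ) = 0 then p else q) ≤
      d (fun i => if (i : ℕ) = 0 then p else a) + d (fun i => if (i : ℕ) = 0 then a else q) := by
  have hk : 1 ≤ k := le_trans (Nat.le_add_left 1 γ) hd.param_le
  have h := hd.triangle (fun i => if (i : ℕ) = 0 then p else q) a 1 le_rfl hk
  refine h.trans (le_of_eq ?_)
  congr 2 <;> funext i <;> by_cases hi : (i : ℕ) = 0 <;> simp [hi]

theorem pairDist_triangle (hd : IsHMetric k d γ) (p a q : χ) :
    pairDist d p q ≤ pairDist d p a + pairDist d a q := by
  have h1 := hd.single_triangle p q a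
  have h2 := hd.single_triangle q p a
  unfold pairDist
  linarith

/-- By symmetry the odd point may be moved to the front, which is where `pairDist` expects it. -/
theorem single_eq (hd : IsHMetric k d γ) (p a : χ) (j : Fin k) :
    d (fun i => if i = j then p else a) = d (fun i => if (i : ℕ) = 0 then p else a) := by
  have hk : 0 < k := j.pos
  rw [← hd.symm (Equiv.swap j ⟨0, hk⟩)]
  congr 1
  funext i
  have : (Equiv.swap j ⟨0, hk⟩ i = j) ↔ ((i : ℕ) = 0) := by
    rw [Equiv.swap_apply_eq_iff, Equiv.swap_apply_left, Fin.ext_iff]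
  simp [this]

/-- The value at `p` is at most the length of the star that joins all the points to `a`. -/
theorem le_star (hd : IsHMetric k d γ) (p : Fin k → χ) (a : χ) :
    d p ≤ ∑ j, pairDist d (p j) a := by
  -- The points are replaced by $a$ one at a time. Applied with index $j+1$ to
  -- $(a,\dots,a,p_j,p_{j+1},\dots)$, the triangle inequality splits off a tuple that differs from
  -- the constant $a$ only at position $j$.
  have key : ∀ j : ℕ, j ≤ k →
      d p ≤ (∑ i : Fin k with i.val < j, pairDist d (p i) a) +
        d (fun i => if (i : ℕ) < j then a else p i) := by
    intro j
    induction j with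
    | zero => intro _; simp
    | succ j ih =>
      intro hj
      have h1 := ih (by omega)
      have h2 := hd.triangle (fun i : Fin k => if (i : ℕ) < j then a else p i) a (j + 1) (by omega) hj
      have e1 : (fun i : Fin k => if (i : ℕ) < j + 1 then
            (if (i : ℕ) < j then a else p i) else a) =
          fun i => if i = ⟨j, hj⟩ then p ⟨j, hj⟩ else a := by
        funext i
        rcases lt_trichotomy (i : ℕ) j with h | h | h
        · have : i ≠ ⟨j, hj⟩ := fun e => by simp [e] at h
          simp [h, this]
        · have : i = ⟨j, hj⟩ := Fin.ext h
          subst this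
          simp
        · have : i ≠ ⟨j, hj⟩ := fun e => by simp [e] at h
          have h' : ¬ (i : ℕ) < j + 1 := by omega
          simp [h', this]
      have e2 : (fun i : Fin k => if (i : ℕ) < j + 1 then a else
            (if (i : ℕ) < j then a else p i)) =
          fun i : Fin k => if (i : ℕ) < j + 1 then a else p i := by
        funext i
        by_cases h : (i : ℕ) < j + 1
        · simp [h]
        · have h' : ¬ (i : ℕ) < j := by omega
          simp [h, h']
      rw [e1, e2, hd.single_eq] at h2
      have h3 : (∑ i : Fin k with i.val < j + 1, pairDist d (p i) a) =
          (∑ i : Fin k with i.val < j, pairDist d (p i) a) + pairDist d (p ⟨j, hj⟩) a := by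
        have : (Finset.univ.filter fun i : Fin k => i.val < j + 1) =
            insert ⟨j, hj⟩ (Finset.univ.filter fun i : Fin k => i.val < j) := by
          ext i
          simp [Fin.ext_iff]
          omega
        rw [this, Finset.sum_insert (by simp), add_comm]
      have h4 : d (fun i => if (i : ℕ) = 0 then p ⟨j, hj⟩ else a) ≤
          pairDist d (p ⟨j, hj⟩) a := le_add_of_nonneg_right (hd.nonneg _)
      linarith
  have h := key k le_rfl
  simpa [hd.const_eq_zero] using h

/-- Each of the two summands uses only points of $p$, so separation bounds it by $\gamma\,d(p)$; for
a proper subset the factor is $1\le\gamma$. -/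
theorem pairDist_le (hd : IsHMetric k d γ) (hγ : 0 < γ) (p : Fin k → χ) (i j : Fin k) :
    pairDist d (p i) (p j) ≤ 2 * γ * d p := by
  have hγ' : (1 : ℝ) ≤ γ := by exact_mod_cast hγ
  have key : ∀ i j : Fin k,
      d (fun l => if (l : ℕ) = 0 then p i else p j) ≤ γ * d p := by
    intro i j
    have hsub : Set.range (fun l : Fin k => if (l : ℕ) = 0 then p i else p j) ⊆ Set.range p := by
      rintro _ ⟨l, rfl⟩
      by_cases h : (l : ℕ) = 0 <;> simp [h]
    rcases hsub.eq_or_ssubset with h | h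
    · exact hd.sep_eq _ _ h
    · have h1 := hd.sep_ssubset _ _ h
      nlinarith [hd.nonneg p]
  have h1 := key i j
  have h2 := key j i
  unfold pairDist
  linarith

end IsHMetric

/-! ### Costs of edges and of groups -/

namespace Instance

variable {χ : Type*} {k γ : ℕ} {d : (Fin k → χ) → ℝ} (σ : Instance χ)

theorem pairDist_le_edgeCost (u v : ℕ) :
    pairDist d (σ.pos u) (σ.pos v) ≤ σ.edgeCost d u v :=
  le_add_of_nonneg_right (abs_nonneg _)

theorem edgeCost_nonneg (hd : IsHMetric k d γ) (u v : ℕ) : 0 ≤ σ.edgeCost d u v :=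
  add_nonneg (hd.pairDist_nonneg _ _) (abs_nonneg _)

theorem distCost_le_star (hd : IsHMetric k d γ) {F : Finset ℕ} (hF : F.card = k) {c : ℝ} (a : χ)
    (hc : ∀ v ∈ F, pairDist d (σ.pos v) a ≤ c) : σ.distCost d F ≤ k * c := by
  rw [distCost, dif_pos hF]
  refine (hd.le_star _ a).trans ?_
  refine (Finset.sum_le_card_nsmul _ _ c fun i _ => hc _ (F.orderEmbOfFin_mem hF i)).trans ?_
  simp

theorem pairDist_le_distCost (hd : IsHMetric k d γ) (hγ : 0 < γ) {F : Finset ℕ}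
    (hF : F.card = k) {u v : ℕ} (hu : u ∈ F) (hv : v ∈ F) :
    pairDist d (σ.pos u) (σ.pos v) ≤ 2 * γ * σ.distCost d F := by
  rw [distCost, dif_pos hF]
  have hr : ∀ w ∈ F, ∃ i, F.orderEmbOfFin hF i = w := by
    intro w hw
    have : w ∈ Set.range (F.orderEmbOfFin hF) := by
      rw [Finset.range_orderEmbOfFin]; exact hw
    exact this
  obtain ⟨i, rfl⟩ := hr u hu
  obtain ⟨j, rfl⟩ := hr v hv
  exact hd.pairDist_le hγ (fun i => σ.pos (F.orderEmbOfFin hF i)) i j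

/-- The edges inside a group cost, up to the factor `γ k²`, no more than the group. -/
theorem sum_edgeCost_le (hd : IsHMetric k d γ) (hγ : 0 < γ) {F : Finset ℕ} (hF : F.card = k)
    {τ : ℝ} (hτ : ∀ v ∈ F, σ.atime v ≤ τ) :
    ∑ u ∈ F, ∑ v ∈ F, 1 / ((γ : ℝ) * (k : ℝ) ^ 2) * σ.edgeCost d u v ≤
      2 * (σ.distCost d F + ∑ v ∈ F, (τ - σ.atime v)) := by
  have hk := hd.two_le hγ
  have hγ' : (1 : ℝ) ≤ γ := by exact_mod_cast hγ
  have hk' : (2 : ℝ) ≤ k := by exact_mod_cast hk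
  set W := ∑ v ∈ F, (τ - σ.atime v) with hW
  set D := σ.distCost d F
  have hW0 : 0 ≤ W := Finset.sum_nonneg fun v hv => sub_nonneg.2 (hτ v hv)
  -- There are $k^2$ ordered pairs, diagonal included, and each waiting time occurs $2k$ times among
  -- the summands; both coefficients are at most $2\gamma k^2$.
  have h1 : ∑ u ∈ F, ∑ v ∈ F, σ.edgeCost d u v ≤ 2 * γ * (k : ℝ) ^ 2 * D + 2 * k * W := by
    have : ∀ u ∈ F, ∀ v ∈ F, σ.edgeCost d u v ≤
        2 * γ * D + ((τ - σ.atime u) + (τ - σ.atime v)) := by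
      intro u hu v hv
      refine add_le_add (σ.pairDist_le_distCost hd hγ hF hu hv) ?_
      have := hτ u hu
      have := hτ v hv
      rw [abs_le]
      constructor <;> linarith
    refine (Finset.sum_le_sum fun u hu => Finset.sum_le_sum fun v hv => this u hu v hv).trans ?_
    simp only [Finset.sum_add_distrib, Finset.sum_const, hF, nsmul_eq_mul, ← hW,
      ← Finset.mul_sum]
    apply le_of_eq
    ring
  simp only [← Finset.mul_sum]
  rw [one_div, inv_mul_le_iff₀ (by positivity)]
  refine h1.trans ?_
  have : (k : ℝ) * W ≤ γ * (k : ℝ) ^ 2 * W := by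
    apply mul_le_mul_of_nonneg_right _ hW0
    nlinarith
  nlinarith

end Instance

/-! ### Groupings and crossing pairs -/

theorem exists_isGrouping {k : ℕ} (hk : 0 < k) (X : Finset ℕ) : ∃ Q, IsGrouping k X Q := by
  induction X using Finset.strongInduction with
  | H X ih =>
    by_cases hX : X.card < k
    · exact ⟨∅, by simp, by simp, by simp, by simpa using hX⟩
    obtain ⟨F, hFX, hF⟩ := Finset.exists_subset_card_eq (not_lt.1 hX)
    have hne : F.Nonempty := Finset.card_pos.1 (hF ▸ hk)
    obtain ⟨Q, hQ⟩ := ih (X \ F) (Finset.sdiff_ssubset hFX hne)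
    refine ⟨insert F Q, ?_, ?_, ?_, ?_⟩
    · intro G hG
      rcases Finset.mem_insert.1 hG with rfl | hG
      · exact hFX
      · exact (hQ.subset G hG).trans Finset.sdiff_subset
    · intro G hG
      rcases Finset.mem_insert.1 hG with rfl | hG
      · exact hF
      · exact hQ.card_eq G hG
    · have aux : ∀ G ∈ Q, Disjoint F G := fun G hG =>
        (Finset.disjoint_sdiff.mono_right (hQ.subset G hG))
      intro G hG G' hG' hGG'
      rcases Finset.mem_insert.1 hG with h | h <;> rcases Finset.mem_insert.1 hG' with h' | h'
      · exact absurd (h.trans h'.symm) hGG'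
      · exact h ▸ aux _ h'
      · exact h' ▸ (aux _ h).symm
      · exact hQ.disjoint G h G' h' hGG'
    · have h : X \ (insert F Q).biUnion id = (X \ F) \ Q.biUnion id := by
        rw [Finset.biUnion_insert, id, sdiff_sdiff_left, Finset.sup_eq_union]
      rw [h]
      exact hQ.rest

/-- A set that splits a group of size `k` crosses at least `k - 1` of its pairs. -/
theorem le_card_crossing (F S : Finset ℕ) (h1 : (F ∩ S).Nonempty) (h2 : (F \ S).Nonempty) :
    2 * (F.card - 1) ≤ ((F ×ˢ F).filter fun e => ¬ (e.1 ∈ S ↔ e.2 ∈ S)).card := by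
  have hsub : (F ∩ S) ×ˢ (F \ S) ∪ (F \ S) ×ˢ (F ∩ S) ⊆
      (F ×ˢ F).filter fun e => ¬ (e.1 ∈ S ↔ e.2 ∈ S) := by
    intro e he
    simp only [Finset.mem_union, Finset.mem_product, Finset.mem_inter, Finset.mem_sdiff,
      Finset.mem_filter] at he ⊢
    tauto
  refine le_trans ?_ (Finset.card_le_card hsub)
  rw [Finset.card_union_of_disjoint, Finset.card_product, Finset.card_product,
    ← Finset.card_inter_add_card_sdiff F S]
  -- With $a+1$ members inside $S$ and $b+1$ outside, the claim is $(a+1)(b+1)\ge a+b+1$, doubled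
  -- for ordered pairs.
  · have ha := h1.card_pos
    have hb := h2.card_pos
    obtain ⟨a, ha⟩ := Nat.exists_eq_add_of_lt ha
    obtain ⟨b, hb⟩ := Nat.exists_eq_add_of_lt hb
    rw [ha, hb]
    have : 0 + a + 1 + (0 + b + 1) - 1 = a + b + 1 := by omega
    rw [this]
    nlinarith [Nat.zero_le (a * b)]
  · rw [Finset.disjoint_left]
    intro e he he'
    simp only [Finset.mem_product, Finset.mem_inter, Finset.mem_sdiff] at he he'
    exact he'.1.2 he.1.2

/-- A set of requests whose size is not a multiple of `k` splits some group of a perfect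
matching. -/
theorem Instance.IsPerfect.exists_split {χ : Type*} {k : ℕ} {σ : Instance χ} {P : Schedule}
    (hP : σ.IsPerfect k P) {S : Finset ℕ} (hS : S ⊆ Finset.range σ.m) (hk : ¬ k ∣ S.card) :
    ∃ x ∈ P, (x.1 ∩ S).Nonempty ∧ (x.1 \ S).Nonempty := by
  by_contra! h
  apply hk
  -- If no group is split, $S$ is a disjoint union of whole groups.
  have hcard : S.card = ∑ x ∈ P, (x.1 ∩ S).card := by
    rw [← Finset.card_biUnion]
    · congr 1
      rw [← Finset.biUnion_inter, hP.cover, Finset.inter_eq_right.2 hS]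
    · intro x hx y hy hxy
      exact (hP.disjoint x hx y hy hxy).mono Finset.inter_subset_left Finset.inter_subset_left
  rw [hcard]
  refine Finset.dvd_sum fun x hx => ?_
  rcases Finset.eq_empty_or_nonempty (x.1 ∩ S) with h0 | h0
  · simp [h0]
  · have h3 := h x hx h0
    rw [Finset.sdiff_eq_empty_iff_subset] at h3
    rw [Finset.inter_eq_left.2 h3, hP.card_eq x hx]

theorem Instance.IsPerfect.card_mul {χ : Type*} {k : ℕ} {σ : Instance χ} {P : Schedule}
    (hP : σ.IsPerfect k P) : P.card * k = σ.m := by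
  have h := congrArg Finset.card hP.cover
  rw [Finset.card_biUnion (fun x hx y hy hxy => hP.disjoint x hx y hy hxy),
    Finset.card_range, Finset.sum_congr rfl hP.card_eq] at h
  simpa using h

end KMPMD

namespace KMPMD

/-! ### Structural invariants of the states -/

namespace State

variable {χ : Type*} {k γ : ℕ} {σ : Instance χ} {s : State}

/-- The matched requests. -/
def matched (s : State) : Finset ℕ := s.matching.biUnion Prod.fst

/-- The active sets that contain a free request. -/
def growing (s : State) : Finset (Finset ℕ) := s.active.filter fun S => (s.free S).Nonempty

/-- The active sets partition the arrived requests, and the matching is a timed partial matching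
that respects the active sets and leaves fewer than `k` free requests in each of them. -/
structure WF (k : ℕ) (σ : Instance χ) (s : State) : Prop where
  n_le : s.n ≤ σ.m
  arrived : ∀ i, i < s.n → σ.atime i ≤ s.time
  pending : ∀ i, s.n ≤ i → i < σ.m → s.time ≤ σ.atime i
  A_subset : ∀ u, u < s.n → s.A u ⊆ Finset.range s.n
  mem_A : ∀ u, u < s.n → u ∈ s.A u
  A_eq : ∀ u, u < s.n → ∀ v ∈ s.A u, s.A v = s.A u
  card_eq : ∀ x ∈ s.matching, x.1.card = k
  disjoint : ∀ x ∈ s.matching, ∀ y ∈ s.matching, x ≠ y → Disjoint x.1 y.1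
  matching_arrived : ∀ x ∈ s.matching, ∀ v ∈ x.1, σ.atime v ≤ x.2
  subset_A : ∀ x ∈ s.matching, ∃ u, u < s.n ∧ x.1 ⊆ s.A u
  free_card_lt : ∀ u, u < s.n → (s.free (s.A u)).card < k

theorem mem_active {S : Finset ℕ} : S ∈ s.active ↔ ∃ u, u < s.n ∧ s.A u = S := by
  simp [active]

theorem mem_growing {S : Finset ℕ} : S ∈ s.growing ↔ S ∈ s.active ∧ (s.free S).Nonempty := by
  simp [growing]

theorem free_eq (s : State) (S : Finset ℕ) : s.free S = S \ s.matched := rfl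

theorem WF.init (k : ℕ) (σ : Instance χ) : WF k σ State.init := by
  constructor <;> simp [State.init]
  exact σ.atime_nonneg

theorem matched_merge (s : State) (u v : ℕ) (Q : Finset (Finset ℕ)) :
    (s.merge u v Q).matched = s.matched ∪ Q.biUnion id := by
  ext w
  simp only [matched, merge, Finset.mem_biUnion, Finset.mem_union, Finset.mem_image, id]
  constructor
  · rintro ⟨x, hx | ⟨F, hF, rfl⟩, hw⟩
    · exact Or.inl ⟨x, hx, hw⟩
    · exact Or.inr ⟨F, hF, hw⟩
  · rintro (⟨x, hx, hw⟩ | ⟨F, hF, hw⟩)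
    · exact ⟨x, Or.inl hx, hw⟩
    · exact ⟨(F, s.time), Or.inr ⟨F, hF, rfl⟩, hw⟩

namespace WF

theorem lt_of_mem (h : s.WF k σ) {u x : ℕ} (hu : u < s.n) (hx : x ∈ s.A u) : x < s.n :=
  Finset.mem_range.1 (h.A_subset u hu hx)

theorem eq_of_mem_active (h : s.WF k σ) {S : Finset ℕ} (hS : S ∈ s.active) {x : ℕ} (hx : x ∈ S) :
    s.A x = S := by
  obtain ⟨u, hu, rfl⟩ := mem_active.1 hS
  exact h.A_eq u hu x hx

theorem active_subset (h : s.WF k σ) {S : Finset ℕ} (hS : S ∈ s.active) : S ⊆ Finset.range s.n := by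
  obtain ⟨u, hu, rfl⟩ := mem_active.1 hS
  exact h.A_subset u hu

theorem nonempty_of_mem_active (h : s.WF k σ) {S : Finset ℕ} (hS : S ∈ s.active) : S.Nonempty := by
  obtain ⟨u, hu, rfl⟩ := mem_active.1 hS
  exact ⟨u, h.mem_A u hu⟩

theorem matched_subset (h : s.WF k σ) : s.matched ⊆ Finset.range s.n := by
  intro w hw
  obtain ⟨x, hx, hw⟩ := Finset.mem_biUnion.1 hw
  obtain ⟨u, hu, hsub⟩ := h.subset_A x hx
  exact h.A_subset u hu (hsub hw)

/-- Every matched group lies inside a single active set, so the matched part of an active set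
consists of whole groups. -/
theorem dvd_card_inter_matched (h : s.WF k σ) {u : ℕ} (hu : u < s.n) : k ∣ (s.A u ∩ s.matched).card := by
  have e : s.A u ∩ s.matched = (s.matching.filter fun x => x.1 ⊆ s.A u).biUnion Prod.fst := by
    ext w
    simp only [matched, Finset.mem_inter, Finset.mem_biUnion, Finset.mem_filter]
    constructor
    · rintro ⟨hw, x, hx, hwx⟩
      obtain ⟨v, hv, hsub⟩ := h.subset_A x hx
      have : s.A v = s.A u := (h.A_eq v hv w (hsub hwx)).symm.trans (h.A_eq u hu w hw)
      exact ⟨x, ⟨hx, this ▸ hsub⟩, hwx⟩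
    · rintro ⟨x, ⟨hx, hsub⟩, hwx⟩
      exact ⟨hsub hwx, x, hx, hwx⟩
  rw [e, Finset.card_biUnion fun x hx y hy hxy =>
    h.disjoint x (Finset.mem_filter.1 hx).1 y (Finset.mem_filter.1 hy).1 hxy]
  exact Finset.dvd_sum fun x hx => (h.card_eq x (Finset.mem_filter.1 hx).1).symm.dvd

/-- An active set contains a free request exactly if its size is not a multiple of `k`. -/
theorem not_dvd_of_mem_growing (h : s.WF k σ) {S : Finset ℕ} (hS : S ∈ s.growing) : ¬ k ∣ S.card := by
  obtain ⟨hact, hfree⟩ := mem_growing.1 hS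
  obtain ⟨u, hu, rfl⟩ := mem_active.1 hact
  intro hdvd
  have h1 := h.dvd_card_inter_matched hu
  have h2 := Finset.card_inter_add_card_sdiff (s.A u) s.matched
  have h3 : k ∣ (s.free (s.A u)).card := by
    rw [free_eq]
    exact (Nat.dvd_add_right h1).1 (h2 ▸ hdvd)
  -- The number of free requests would be a positive multiple of $k$ below $k$.
  exact absurd (Nat.le_of_dvd hfree.card_pos h3) (not_le.2 (h.free_card_lt u hu))

theorem arrive (h : s.WF k σ) (hk : 2 ≤ k) (hn : s.n < σ.m) (ht : σ.atime s.n = s.time) :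
    s.arrive.WF k σ := by
  have hA : ∀ u, u < s.n → s.arrive.A u = s.A u := fun u hu => if_neg hu.ne
  have hAn : s.arrive.A s.n = {s.n} := if_pos rfl
  have hcases : ∀ u, u < s.arrive.n → u < s.n ∨ u = s.n := fun u hu =>
    (Nat.lt_succ_iff_lt_or_eq).1 hu
  constructor
  · exact hn
  · intro i hi
    rcases hcases i hi with hi | rfl
    · exact h.arrived i hi
    · exact ht.le
  · intro i hi
    exact h.pending i ((Nat.le_succ _).trans hi)
  · intro u hu
    rcases hcases u hu with hu | rfl
    · rw [hA u hu]
      exact (h.A_subset u hu).trans (Finset.range_mono (Nat.le_succ _))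
    · rw [hAn]
      simp [State.arrive]
  · intro u hu
    rcases hcases u hu with hu | rfl
    · rw [hA u hu]
      exact h.mem_A u hu
    · simp [hAn]
  · intro u hu v hv
    rcases hcases u hu with hu | rfl
    · rw [hA u hu] at hv ⊢
      rw [hA v (h.lt_of_mem hu hv)]
      exact h.A_eq u hu v hv
    · rw [hAn, Finset.mem_singleton] at hv
      rw [hv]
  · exact h.card_eq
  · exact h.disjoint
  · exact h.matching_arrived
  · intro x hx
    obtain ⟨u, hu, hsub⟩ := h.subset_A x hx
    exact ⟨u, hu.trans (Nat.lt_succ_self _), by rwa [hA u hu]⟩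
  · intro u hu
    rcases hcases u hu with hu | rfl
    · rw [hA u hu]
      exact h.free_card_lt u hu
    · rw [hAn]
      refine lt_of_le_of_lt (Finset.card_le_card Finset.sdiff_subset) ?_
      rw [Finset.card_singleton]
      omega

theorem elapse (h : s.WF k σ) {r δ : ℝ} (hδ : 0 < δ)
    (harr : ∀ i, s.n ≤ i → i < σ.m → s.time + δ ≤ σ.atime i) :
    (s.elapse r δ).WF k σ where
  n_le := h.n_le
  arrived i hi := (h.arrived i hi).trans (le_add_of_nonneg_right hδ.le)
  pending := harr
  A_subset := h.A_subset
  mem_A := h.mem_A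
  A_eq := h.A_eq
  card_eq := h.card_eq
  disjoint := h.disjoint
  matching_arrived := h.matching_arrived
  subset_A := h.subset_A
  free_card_lt := h.free_card_lt

theorem merge_A_of_notMem {u v w : ℕ} {Q : Finset (Finset ℕ)} (hw : w ∉ s.A u ∪ s.A v) :
    (s.merge u v Q).A w = s.A w := if_neg hw

theorem merge_A_of_mem {u v w : ℕ} {Q : Finset (Finset ℕ)} (hw : w ∈ s.A u ∪ s.A v) :
    (s.merge u v Q).A w = s.A u ∪ s.A v := if_pos hw

theorem A_subset_merge (h : s.WF k σ) {u v w : ℕ} (Q : Finset (Finset ℕ)) (hu : u < s.n) (hv : v < s.n) :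
    s.A w ⊆ (s.merge u v Q).A w := by
  by_cases hw : w ∈ s.A u ∪ s.A v
  · rw [merge_A_of_mem hw]
    rcases Finset.mem_union.1 hw with hw | hw
    · rw [h.A_eq u hu w hw]
      exact Finset.subset_union_left
    · rw [h.A_eq v hv w hw]
      exact Finset.subset_union_right
  · rw [merge_A_of_notMem hw]

theorem merge (h : s.WF k σ) {u v : ℕ} {Q : Finset (Finset ℕ)} (hu : u < s.n) (hv : v < s.n)
    (hQ : IsGrouping k (s.free (s.A u ∪ s.A v)) Q) : (s.merge u v Q).WF k σ := by
  have hB : s.A u ∪ s.A v ⊆ Finset.range s.n :=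
    Finset.union_subset (h.A_subset u hu) (h.A_subset v hv)
  have hB' : ∀ w, w < s.n → w ∉ s.A u ∪ s.A v → ∀ x ∈ s.A w, x ∉ s.A u ∪ s.A v := by
    intro w hw hwB x hx hxB
    apply hwB
    rcases Finset.mem_union.1 hxB with hxB | hxB
    · rw [← h.A_eq u hu x hxB, h.A_eq w hw x hx]
      exact Finset.mem_union_left _ (h.mem_A w hw)
    · rw [← h.A_eq v hv x hxB, h.A_eq w hw x hx]
      exact Finset.mem_union_right _ (h.mem_A w hw)
  have hQm : ∀ F ∈ Q, Disjoint F s.matched := fun F hF =>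
    Finset.disjoint_of_subset_left (hQ.subset F hF) Finset.sdiff_disjoint
  have hQB : ∀ F ∈ Q, F ⊆ s.A u ∪ s.A v := fun F hF =>
    (hQ.subset F hF).trans Finset.sdiff_subset
  have hmem : ∀ x, x ∈ (s.merge u v Q).matching →
      x ∈ s.matching ∨ (x.1 ∈ Q ∧ x.2 = s.time) := by
    intro x hx
    rcases Finset.mem_union.1 hx with hx | hx
    · exact Or.inl hx
    · obtain ⟨F, hF, rfl⟩ := Finset.mem_image.1 hx
      exact Or.inr ⟨hF, rfl⟩
  have hfree : ∀ S, (s.merge u v Q).free S = s.free S \ Q.biUnion id := by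
    intro S
    rw [free_eq, free_eq, matched_merge, sdiff_sdiff_left, Finset.sup_eq_union]
  constructor
  · exact h.n_le
  · exact h.arrived
  · exact h.pending
  · intro w hw
    by_cases hwB : w ∈ s.A u ∪ s.A v
    · rw [merge_A_of_mem hwB]
      exact hB
    · rw [merge_A_of_notMem hwB]
      exact h.A_subset w hw
  · intro w hw
    exact h.A_subset_merge Q hu hv (h.mem_A w hw)
  · intro w hw x hx
    by_cases hwB : w ∈ s.A u ∪ s.A v
    · rw [merge_A_of_mem hwB] at hx ⊢
      exact merge_A_of_mem hx
    · rw [merge_A_of_notMem hwB] at hx ⊢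
      rw [merge_A_of_notMem (hB' w hw hwB x hx)]
      exact h.A_eq w hw x hx
  · intro x hx
    rcases hmem x hx with hx | ⟨hx, -⟩
    · exact h.card_eq x hx
    · exact hQ.card_eq _ hx
  · intro x hx y hy hxy
    have hm : ∀ x ∈ s.matching, x.1 ⊆ s.matched := fun x hx =>
      Finset.subset_biUnion_of_mem Prod.fst hx
    rcases hmem x hx with hx | ⟨hx, hx2⟩ <;> rcases hmem y hy with hy | ⟨hy, hy2⟩
    · exact h.disjoint x hx y hy hxy
    · exact ((hQm _ hy).mono_right (hm x hx)).symm
    · exact (hQm _ hx).mono_right (hm y hy)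
    · exact hQ.disjoint _ hx _ hy fun e => hxy (Prod.ext e (hx2.trans hy2.symm))
  · intro x hx w hw
    rcases hmem x hx with hx | ⟨hx, hx2⟩
    · exact h.matching_arrived x hx w hw
    · rw [hx2]
      exact h.arrived w (Finset.mem_range.1 (hB (hQB _ hx hw)))
  · intro x hx
    rcases hmem x hx with hx | ⟨hx, -⟩
    · obtain ⟨w, hw, hsub⟩ := h.subset_A x hx
      exact ⟨w, hw, hsub.trans (h.A_subset_merge Q hu hv)⟩
    · refine ⟨u, hu, ?_⟩
      rw [merge_A_of_mem (Finset.mem_union_left _ (h.mem_A u hu))]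
      exact hQB _ hx
  · intro w hw
    rw [hfree]
    by_cases hwB : w ∈ s.A u ∪ s.A v
    · rw [merge_A_of_mem hwB]
      exact hQ.rest
    · rw [merge_A_of_notMem hwB]
      exact (Finset.card_le_card Finset.sdiff_subset).trans_lt (h.free_card_lt w hw)

end WF

theorem WF.step {d : (Fin k → χ) → ℝ} {r : ℝ} {s' : State} (hk : 2 ≤ k) (h : s.WF k σ)
    (hs : Step d γ r σ s s') : s'.WF k σ := by
  cases hs with
  | arrive hn ht => exact h.arrive hk hn ht
  | merge u v Q huv hQ => exact h.merge huv.1 huv.2.1 hQ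
  | elapse δ hδ harr htight hevent => exact h.elapse hδ harr

theorem WF.of_reachable {d : (Fin k → χ) → ℝ} {r : ℝ} (hk : 2 ≤ k)
    (hs : Reachable d γ r σ s) : s.WF k σ := by
  induction hs with
  | refl => exact WF.init k σ
  | tail _ hstep ih => exact ih.step hk hstep

end State

end KMPMD

namespace KMPMD

namespace State

variable {χ : Type*} {k γ : ℕ} {σ : Instance χ} {s : State} {d : (Fin k → χ) → ℝ} {r : ℝ}

/-! ### Sums of dual variables -/

/-- The sum of `y_S` over the sets `S` of arrived requests with the property `p`. -/
def ySum (s : State) (p : Finset ℕ → Prop) [DecidablePred p] : ℝ :=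
  ∑ S ∈ (Finset.range s.n).powerset with p S, s.y S

theorem load_eq_ySum (s : State) (u v : ℕ) :
    s.load u v = s.ySum fun S => ¬ (u ∈ S ↔ v ∈ S) := rfl

theorem ySum_nonneg (hy : ∀ S, 0 ≤ s.y S) (p : Finset ℕ → Prop) [DecidablePred p] :
    0 ≤ s.ySum p := Finset.sum_nonneg fun S _ => hy S

theorem ySum_eq_zero {p : Finset ℕ → Prop} [DecidablePred p] (hp : ∀ S, s.y S ≠ 0 → ¬ p S) :
    s.ySum p = 0 :=
  Finset.sum_eq_zero fun S hS => by
    by_contra h0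
    exact hp S h0 (Finset.mem_filter.1 hS).2

theorem ySum_le_add (hy : ∀ S, 0 ≤ s.y S) {p q q' : Finset ℕ → Prop} [DecidablePred p]
    [DecidablePred q] [DecidablePred q'] (hp : ∀ S, s.y S ≠ 0 → p S → q S ∨ q' S) :
    s.ySum p ≤ s.ySum q + s.ySum q' := by
  simp only [ySum, Finset.sum_filter, ← Finset.sum_add_distrib]
  refine Finset.sum_le_sum fun S _ => ?_
  have h0 := hy S
  by_cases hS : s.y S = 0
  · simp [hS]
  · have := hp S hS
    split_ifs <;> first | linarith | tauto

/-- Exclusiveness is required on the support of $y$ only, since the empty set is contained in any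
two disjoint active sets. -/
theorem ySum_add_le (hy : ∀ S, 0 ≤ s.y S) {p q q' : Finset ℕ → Prop} [DecidablePred p]
    [DecidablePred q] [DecidablePred q'] (hq : ∀ S, q S → p S) (hq' : ∀ S, q' S → p S)
    (hqq' : ∀ S, s.y S ≠ 0 → q S → ¬ q' S) :
    s.ySum q + s.ySum q' ≤ s.ySum p := by
  simp only [ySum, Finset.sum_filter, ← Finset.sum_add_distrib]
  refine Finset.sum_le_sum fun S _ => ?_
  have h0 := hy S
  by_cases hS : s.y S = 0
  · simp [hS]
  · have := hqq' S hS
    have := hq S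
    have := hq' S
    split_ifs <;> first | linarith | tauto

theorem ySum_mono (hy : ∀ S, 0 ≤ s.y S) {p q : Finset ℕ → Prop} [DecidablePred p]
    [DecidablePred q] (hp : ∀ S, p S → q S) : s.ySum p ≤ s.ySum q := by
  have h := ySum_add_le (s := s) hy (q' := fun _ => False) hp (fun S hS => hS.elim) (by simp)
  have h0 : s.ySum (fun _ => False) = 0 := ySum_eq_zero (by simp)
  linarith

/-- The range of summation gains only sets that contain the new request, and there $y$ is reset to
$0$. -/
theorem ySum_arrive (s : State) (p : Finset ℕ → Prop) [DecidablePred p] :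
    s.arrive.ySum p = s.ySum p := by
  symm
  apply Finset.sum_subset_zero_on_sdiff
  · exact Finset.filter_subset_filter _
      (Finset.powerset_mono.2 (Finset.range_mono (Nat.le_succ _)))
  · intro S hS
    simp only [Finset.mem_sdiff, Finset.mem_filter, Finset.mem_powerset, not_and] at hS
    obtain ⟨⟨h1, h2⟩, h3⟩ := hS
    have hn : s.n ∈ S := by
      by_contra hn
      refine h3 (fun w hw => ?_) h2
      have hw' : w < s.n + 1 := Finset.mem_range.1 (h1 hw)
      have : w ≠ s.n := fun e => hn (e ▸ hw)
      exact Finset.mem_range.2 (by omega)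
    exact if_pos hn
  · intro S hS
    have hS' := Finset.mem_powerset.1 (Finset.mem_filter.1 hS).1
    have hn : s.n ∉ S := fun hn => lt_irrefl _ (Finset.mem_range.1 (hS' hn))
    exact (if_neg hn).symm

theorem elapse_y (s : State) (r δ : ℝ) (S : Finset ℕ) :
    (s.elapse r δ).y S = s.y S + if S ∈ s.growing then r * δ else 0 := by
  simp only [elapse, mem_growing]
  split_ifs <;> simp

/-- This reduces the effect of passing time on each dual invariant to counting growing sets. -/
theorem WF.ySum_elapse (h : s.WF k σ) (r δ : ℝ) (p : Finset ℕ → Prop) [DecidablePred p] :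
    (s.elapse r δ).ySum p = s.ySum p + r * δ * (s.growing.filter p).card := by
  have hn : (s.elapse r δ).n = s.n := rfl
  simp only [ySum, elapse_y, Finset.sum_add_distrib, hn, add_right_inj]
  rw [← Finset.sum_filter, Finset.sum_const, nsmul_eq_mul, mul_comm]
  congr 3
  ext S
  simp only [Finset.mem_filter, Finset.mem_powerset]
  constructor
  · rintro ⟨⟨-, h1⟩, h2⟩
    exact ⟨h2, h1⟩
  · rintro ⟨h2, h1⟩
    exact ⟨⟨h.active_subset (mem_growing.1 h2).1, h1⟩, h2⟩

/-- As active sets form a partition, both families are $\{A(u)\}$ or both are empty. This keeps the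
distance invariant balanced while time passes. -/
theorem WF.filter_growing_subset (h : s.WF k σ) {u x : ℕ} (hu : u < s.n) (hx : x ∈ s.A u) :
    (s.growing.filter fun S => x ∈ S) = s.growing.filter fun S => S ⊆ s.A u := by
  refine Finset.filter_congr fun S hS => ?_
  have hact := (mem_growing.1 hS).1
  constructor
  · intro hxS
    rw [← h.eq_of_mem_active hact hxS, h.A_eq u hu x hx]
  · intro hSu
    obtain ⟨w, hw⟩ := h.nonempty_of_mem_active hact
    rw [← h.eq_of_mem_active hact hw, h.A_eq u hu w (hSu hw)]
    exact hx

theorem WF.card_filter_mem_le (h : s.WF k σ) (x : ℕ) :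
    (s.growing.filter fun S => x ∈ S).card ≤ 1 := by
  rw [Finset.card_le_one]
  intro S hS T hT
  simp only [Finset.mem_filter, mem_growing] at hS hT
  rw [← h.eq_of_mem_active hS.1.1 hS.2, h.eq_of_mem_active hT.1.1 hT.2]

theorem WF.filter_crossing_eq_empty (h : s.WF k σ) {u v : ℕ} (hu : u < s.n) (hv : v < s.n)
    (huv : s.A u = s.A v) : (s.growing.filter fun S => ¬ (u ∈ S ↔ v ∈ S)) = ∅ := by
  refine Finset.filter_eq_empty_iff.2 fun S hS => not_not.2 ?_
  have hact := (mem_growing.1 hS).1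
  constructor
  · intro hS
    rw [← h.eq_of_mem_active hact hS, huv]
    exact h.mem_A v hv
  · intro hS
    rw [← h.eq_of_mem_active hact hS, ← huv]
    exact h.mem_A u hu

/-- The number of free requests, in terms of the growing sets. -/
theorem WF.card_free_le (h : s.WF k σ) :
    (s.free (Finset.range s.n)).card ≤ s.growing.card * (k - 1) := by
  have hsub : s.free (Finset.range s.n) ⊆ s.growing.biUnion s.free := by
    intro w hw
    have hw' := Finset.mem_sdiff.1 hw
    have hwn := Finset.mem_range.1 hw'.1
    have hwf : w ∈ s.free (s.A w) := Finset.mem_sdiff.2 ⟨h.mem_A w hwn, hw'.2⟩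
    exact Finset.mem_biUnion.2
      ⟨s.A w, mem_growing.2 ⟨mem_active.2 ⟨w, hwn, rfl⟩, ⟨w, hwf⟩⟩, hwf⟩
  refine (Finset.card_le_card hsub).trans (Finset.card_biUnion_le_card_mul _ _ _ ?_)
  intro S hS
  obtain ⟨u, hu, rfl⟩ := mem_active.1 (mem_growing.1 hS).1
  exact Nat.le_sub_one_of_lt (h.free_card_lt u hu)

/-! ### Invariants of the dual solution -/

/-- The total waiting time until now. -/
def waiting (s : State) (σ : Instance χ) : ℝ :=
  ∑ x ∈ s.matching, ∑ v ∈ x.1, (x.2 - σ.atime v) +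
    ∑ v ∈ s.free (Finset.range s.n), (s.time - σ.atime v)

/-- The dual variables form a feasible dual solution, supported on subsets of the active sets,
that pays for the distances inside each active set and for the waiting time. -/
structure Dual (d : (Fin k → χ) → ℝ) (r : ℝ) (σ : Instance χ) (s : State) : Prop where
  y_nonneg : ∀ S, 0 ≤ s.y S
  nonempty : ∀ S, s.y S ≠ 0 → S.Nonempty
  subset_A : ∀ S, s.y S ≠ 0 → ∃ u, u < s.n ∧ S ⊆ s.A u
  not_dvd : ∀ S, s.y S ≠ 0 → ¬ k ∣ S.card
  ySum_mem_le : ∀ u, u < s.n → s.ySum (fun S => u ∈ S) ≤ r * (s.time - σ.atime u)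
  load_le : ∀ u v, u < s.n → v < s.n → s.load u v ≤ r * σ.edgeCost d u v
  pairDist_le : ∀ u, u < s.n → ∀ x ∈ s.A u, ∀ z ∈ s.A u,
    r * pairDist d (σ.pos x) (σ.pos z) + s.ySum (fun S => x ∈ S) + s.ySum (fun S => z ∈ S) ≤
      2 * s.ySum fun S => S ⊆ s.A u
  waiting_le : r * s.waiting σ ≤ (k - 1) * s.ySum fun _ => True

theorem Dual.init (d : (Fin k → χ) → ℝ) (r : ℝ) (σ : Instance χ) : Dual d r σ State.init := by
  constructor <;> simp [State.init, State.waiting, State.free, State.ySum]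

theorem load_le_add (hy : ∀ S, 0 ≤ s.y S) (u v : ℕ) :
    s.load u v ≤ s.ySum (fun S => u ∈ S) + s.ySum fun S => v ∈ S := by
  rw [load_eq_ySum]
  exact ySum_le_add hy fun S _ hS => by tauto

/-! ### Preservation of the dual invariants by the three kinds of events -/

namespace Dual

theorem arrive (hD : s.Dual d r σ) (h : s.WF k σ) (hd : IsHMetric k d γ) (hr : 0 < r)
    (ht : σ.atime s.n = s.time) : s.arrive.Dual d r σ := by
  have hA : ∀ u, u < s.n → s.arrive.A u = s.A u := fun u hu => if_neg hu.ne
  have hAn : s.arrive.A s.n = {s.n} := if_pos rfl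
  have hcases : ∀ u, u < s.arrive.n → u < s.n ∨ u = s.n := fun u hu =>
    (Nat.lt_succ_iff_lt_or_eq).1 hu
  have hy : ∀ S, s.arrive.y S ≠ 0 → s.y S ≠ 0 := by
    intro S hS h0
    apply hS
    simp [State.arrive, h0]
  have hnot : ∀ S, s.y S ≠ 0 → s.n ∉ S := by
    intro S hS hmem
    obtain ⟨u, hu, hsub⟩ := hD.subset_A S hS
    exact lt_irrefl _ (h.lt_of_mem hu (hsub hmem))
  have hzero : s.ySum (fun S => s.n ∈ S) = 0 := ySum_eq_zero hnot
  have htime : s.arrive.time = s.time := rfl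
  constructor
  · intro S
    simp only [State.arrive]
    split_ifs
    exacts [le_rfl, hD.y_nonneg S]
  · exact fun S hS => hD.nonempty S (hy S hS)
  · intro S hS
    obtain ⟨u, hu, hsub⟩ := hD.subset_A S (hy S hS)
    exact ⟨u, hu.trans (Nat.lt_succ_self _), by rwa [hA u hu]⟩
  · exact fun S hS => hD.not_dvd S (hy S hS)
  · intro u hu
    rw [ySum_arrive, htime]
    rcases hcases u hu with hu | rfl
    · exact hD.ySum_mem_le u hu
    · rw [hzero, ht, sub_self, mul_zero]
  · intro u v hu hv
    -- The weight around an old request is at most $r$ times its age, which is now its time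
    -- difference to the newcomer. The newcomer carries no weight, so all its edges are feasible.
    have hle : ∀ w, w < s.n → s.ySum (fun S => w ∈ S) ≤ r * |σ.atime w - σ.atime s.n| := by
      intro w hw
      refine (hD.ySum_mem_le w hw).trans (mul_le_mul_of_nonneg_left ?_ hr.le)
      rw [← ht, abs_sub_comm]
      exact le_abs_self _
    have habs : ∀ u v, r * |σ.atime u - σ.atime v| ≤ r * σ.edgeCost d u v := fun u v =>
      mul_le_mul_of_nonneg_left (le_add_of_nonneg_left (hd.pairDist_nonneg _ _)) hr.le
    rw [load_eq_ySum, ySum_arrive, ← load_eq_ySum]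
    rcases hcases u hu with hu | rfl <;> rcases hcases v hv with hv | rfl
    · exact hD.load_le u v hu hv
    · refine (load_le_add hD.y_nonneg _ _).trans ?_
      rw [hzero, add_zero]
      exact (hle u hu).trans (habs _ _)
    · refine (load_le_add hD.y_nonneg _ _).trans ?_
      rw [hzero, zero_add]
      refine (hle v hv).trans ?_
      rw [abs_sub_comm]
      exact habs _ _
    · refine (load_le_add hD.y_nonneg _ _).trans ?_
      rw [hzero, zero_add]
      exact mul_nonneg hr.le (σ.edgeCost_nonneg hd _ _)
  · intro u hu x hx z hz
    simp only [ySum_arrive]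
    rcases hcases u hu with hu | rfl
    · simp only [hA u hu] at hx hz ⊢
      exact hD.pairDist_le u hu x hx z hz
    · rw [hAn, Finset.mem_singleton] at hx hz
      subst hx hz
      rw [hzero, hd.pairDist_self]
      have := ySum_nonneg hD.y_nonneg fun S => S ⊆ s.arrive.A s.n
      linarith
  · rw [ySum_arrive]
    refine le_of_eq_of_le ?_ hD.waiting_le
    congr 1
    unfold waiting
    congr 1
    have hnm : s.n ∉ s.matched := fun hmem =>
      lt_irrefl _ (Finset.mem_range.1 (h.matched_subset hmem))
    have : s.arrive.free (Finset.range s.arrive.n) = insert s.n (s.free (Finset.range s.n)) := by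
      have e1 : s.arrive.n = s.n + 1 := rfl
      have e2 : s.arrive.matched = s.matched := rfl
      rw [free_eq, free_eq, e1, e2, Finset.range_add_one, Finset.insert_sdiff_of_notMem _ hnm]
    rw [this, Finset.sum_insert, htime, ht, sub_self, zero_add]
    simp [free_eq]

theorem merge (hD : s.Dual d r σ) (h : s.WF k σ) (hd : IsHMetric k d γ) (hr : 0 < r)
    {u v : ℕ} {Q : Finset (Finset ℕ)} (hu : u < s.n) (hv : v < s.n) (huv : s.A u ≠ s.A v)
    (ht : s.load u v = r * σ.edgeCost d u v) (hk : 0 < k)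
    (hQ : IsGrouping k (s.free (s.A u ∪ s.A v)) Q) : (s.merge u v Q).Dual d r σ := by
  have hn : (s.merge u v Q).n = s.n := rfl
  have htime : (s.merge u v Q).time = s.time := rfl
  have hsum : ∀ (p : Finset ℕ → Prop) [DecidablePred p], (s.merge u v Q).ySum p = s.ySum p :=
    fun p _ => rfl
  constructor
  · exact hD.y_nonneg
  · exact hD.nonempty
  · intro S hS
    obtain ⟨w, hw, hsub⟩ := hD.subset_A S hS
    exact ⟨w, hw, hsub.trans (h.A_subset_merge Q hu hv)⟩
  · exact hD.not_dvd
  · exact hD.ySum_mem_le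
  · exact hD.load_le
  · intro w hw x hx z hz
    simp only [hsum]
    by_cases hwB : w ∈ s.A u ∪ s.A v
    · simp only [WF.merge_A_of_mem hwB] at hx hz ⊢
      have hdisj : Disjoint (s.A u) (s.A v) := by
        rw [Finset.disjoint_left]
        intro a ha ha'
        exact huv ((h.A_eq u hu a ha).symm.trans (h.A_eq v hv a ha'))
      have hB : s.ySum (fun S => S ⊆ s.A u) + s.ySum (fun S => S ⊆ s.A v) ≤
          s.ySum fun S => S ⊆ s.A u ∪ s.A v := by
        refine ySum_add_le hD.y_nonneg (fun S hS => hS.trans Finset.subset_union_left)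
          (fun S hS => hS.trans Finset.subset_union_right) fun S hS h1 h2 => ?_
        obtain ⟨a, ha⟩ := hD.nonempty S hS
        exact Finset.disjoint_left.1 hdisj (h1 ha) (h2 ha)
      have hu0 := ySum_nonneg hD.y_nonneg fun S => S ⊆ s.A u
      have hv0 := ySum_nonneg hD.y_nonneg fun S => S ⊆ s.A v
      have hedge : r * pairDist d (σ.pos u) (σ.pos v) ≤
          s.ySum (fun S => u ∈ S) + s.ySum fun S => v ∈ S :=
        (mul_le_mul_of_nonneg_left (σ.pairDist_le_edgeCost u v) hr.le).trans
          (ht ▸ load_le_add hD.y_nonneg u v)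
      -- Along the path $x,u,v,z$, the invariants for $(x,u)$ and $(v,z)$ leave $y(u)+y(v)$ to
      -- spare, which covers the tight edge $uv$.
      have hcross : ∀ x ∈ s.A u, ∀ z ∈ s.A v, r * pairDist d (σ.pos x) (σ.pos z) +
          s.ySum (fun S => x ∈ S) + s.ySum (fun S => z ∈ S) ≤
            2 * s.ySum fun S => S ⊆ s.A u ∪ s.A v := by
        intro x hx z hz
        have h1 := hD.pairDist_le u hu x hx u (h.mem_A u hu)
        have h2 := hD.pairDist_le v hv v (h.mem_A v hv) z hz
        have h3 := mul_le_mul_of_nonneg_left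
          ((hd.pairDist_triangle (σ.pos x) (σ.pos u) (σ.pos z)).trans
            (add_le_add_right (hd.pairDist_triangle (σ.pos u) (σ.pos v) (σ.pos z)) _)) hr.le
        simp only [mul_add] at h3
        linarith
      rcases Finset.mem_union.1 hx with hx | hx <;> rcases Finset.mem_union.1 hz with hz | hz
      · have := hD.pairDist_le u hu x hx z hz
        linarith
      · exact hcross x hx z hz
      · have := hcross z hz x hx
        rw [IsHMetric.pairDist_comm]
        linarith
      · have := hD.pairDist_le v hv x hx z hz
        linarith
    · simp only [WF.merge_A_of_notMem hwB] at hx hz ⊢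
      exact hD.pairDist_le w hw x hx z hz
  · rw [hsum]
    refine le_of_eq_of_le ?_ hD.waiting_le
    congr 1
    -- Newly matched requests move from the free sum to the matched sum with the same waiting time,
    -- so the total is unchanged.
    have hQfree : Q.biUnion id ⊆ s.free (Finset.range s.n) := by
      refine Finset.biUnion_subset.2 fun F hF => (hQ.subset F hF).trans ?_
      exact Finset.sdiff_subset_sdiff
        (Finset.union_subset (h.A_subset u hu) (h.A_subset v hv)) (Finset.Subset.refl _)
    have hfree : (s.merge u v Q).free (Finset.range s.n) =
        s.free (Finset.range s.n) \ Q.biUnion id := by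
      rw [free_eq, free_eq, matched_merge, sdiff_sdiff_left, Finset.sup_eq_union]
    have hnew : ∑ x ∈ Q.image (fun F => (F, s.time)), ∑ v ∈ x.1, (x.2 - σ.atime v) =
        ∑ v ∈ Q.biUnion id, (s.time - σ.atime v) := by
      rw [Finset.sum_image (fun F _ G _ e => congrArg Prod.fst e), Finset.sum_biUnion]
      · rfl
      · exact fun F hF G hG hFG => hQ.disjoint F hF G hG hFG
    have hdisj : Disjoint s.matching (Q.image fun F => (F, s.time)) := by
      rw [Finset.disjoint_left]
      intro x hx hx'
      obtain ⟨F, hF, rfl⟩ := Finset.mem_image.1 hx'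
      obtain ⟨a, ha⟩ := Finset.card_pos.1 ((hQ.card_eq F hF).symm ▸ hk)
      exact (Finset.mem_sdiff.1 (hQ.subset F hF ha)).2 (Finset.mem_biUnion.2 ⟨_, hx, ha⟩)
    have hm : (s.merge u v Q).matching = s.matching ∪ Q.image fun F => (F, s.time) := rfl
    unfold waiting
    rw [hn, htime, hfree, hm, Finset.sum_union hdisj, hnew, add_assoc,
      add_comm (∑ v ∈ Q.biUnion id, _), Finset.sum_sdiff hQfree]

theorem elapse (hD : s.Dual d r σ) (h : s.WF k σ) (hr : 0 < r) {δ : ℝ}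
    (hδ : 0 < δ) (hk : 0 < k)
    (htight : ∀ ε : ℝ, 0 ≤ ε → ε < δ → ∀ u v, u < s.n → v < s.n → s.A u ≠ s.A v →
      (s.elapse r ε).load u v ≠ r * σ.edgeCost d u v) :
    (s.elapse r δ).Dual d r σ := by
  have hrδ : 0 < r * δ := mul_pos hr hδ
  have hy : ∀ S, (s.elapse r δ).y S ≠ 0 → s.y S ≠ 0 ∨ S ∈ s.growing := by
    intro S hS
    by_contra! hcon
    apply hS
    simp [elapse_y, hcon]
  have hn : (s.elapse r δ).n = s.n := rfl
  have hA : (s.elapse r δ).A = s.A := rfl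
  have htime : (s.elapse r δ).time = s.time + δ := rfl
  constructor
  · intro S
    rw [elapse_y]
    have := hD.y_nonneg S
    split_ifs <;> linarith
  · intro S hS
    rcases hy S hS with hS | hS
    · exact hD.nonempty S hS
    · exact h.nonempty_of_mem_active (mem_growing.1 hS).1
  · intro S hS
    rcases hy S hS with hS | hS
    · exact hD.subset_A S hS
    · obtain ⟨u, hu, rfl⟩ := mem_active.1 (mem_growing.1 hS).1
      exact ⟨u, hu, Finset.Subset.refl _⟩
  · intro S hS
    rcases hy S hS with hS | hS
    · exact hD.not_dvd S hS
    · exact h.not_dvd_of_mem_growing hS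
  · intro u hu
    rw [h.ySum_elapse, htime]
    have h1 := hD.ySum_mem_le u hu
    have h2 : ((s.growing.filter fun S => u ∈ S).card : ℝ) ≤ 1 := by
      exact_mod_cast h.card_filter_mem_le u
    nlinarith
  · intro u v hu hv
    by_cases huv : s.A u = s.A v
    · rw [load_eq_ySum, h.ySum_elapse, h.filter_crossing_eq_empty hu hv huv,
        Finset.card_empty, Nat.cast_zero, mul_zero, add_zero]
      exact hD.load_le u v hu hv
    · by_contra! hlt
      -- The load is affine in the elapsed time, so exceeding the bound at $\delta$ forces equality
      -- at some earlier moment, against `htight`.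
      obtain ⟨c, hc0, hload⟩ : ∃ c : ℝ, 0 ≤ c ∧
          ∀ ε, (s.elapse r ε).load u v = s.load u v + r * ε * c :=
        ⟨_, Nat.cast_nonneg _, fun ε => by
          rw [load_eq_ySum, h.ySum_elapse, ← load_eq_ySum]⟩
      rw [hload] at hlt
      have h0 := hD.load_le u v hu hv
      have hcpos : 0 < c := by
        rcases hc0.eq_or_lt with h' | h'
        · rw [← h'] at hlt
          linarith
        · exact h'
      have hrc : 0 < r * c := mul_pos hr hcpos
      refine htight ((r * σ.edgeCost d u v - s.load u v) / (r * c)) ?_ ?_ u v hu hv huv ?_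
      · exact div_nonneg (by linarith) hrc.le
      · rw [div_lt_iff₀ hrc]
        linarith
      · rw [hload]
        field_simp
        ring
  · intro u hu x hx z hz
    rw [hA] at hx hz ⊢
    -- All three sums grow by the same amount; it is counted twice on each side.
    rw [h.ySum_elapse, h.ySum_elapse, h.ySum_elapse, h.filter_growing_subset hu hx,
      h.filter_growing_subset hu hz]
    have := hD.pairDist_le u hu x hx z hz
    linarith
  · have hw : (s.elapse r δ).waiting σ =
        s.waiting σ + (s.free (Finset.range s.n)).card * δ := by
      have hf : ∀ S, (s.elapse r δ).free S = s.free S := fun S => rfl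
      have hm : (s.elapse r δ).matching = s.matching := rfl
      unfold waiting
      rw [htime, hn, hf, hm, add_assoc, ← nsmul_eq_mul, ← Finset.sum_const,
        ← Finset.sum_add_distrib]
      congr 1
      exact Finset.sum_congr rfl fun v _ => by ring
    have hcard : ((s.free (Finset.range s.n)).card : ℝ) ≤ s.growing.card * (k - 1) := by
      have := h.card_free_le
      have h' : ((k - 1 : ℕ) : ℝ) = k - 1 := by
        rw [Nat.cast_sub hk, Nat.cast_one]
      rw [← h']
      exact_mod_cast this
    rw [hw, h.ySum_elapse, Finset.filter_true]
    have h1 := hD.waiting_le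
    have h2 := mul_le_mul_of_nonneg_left hcard hrδ.le
    linarith

end Dual

theorem Dual.step {s' : State} (hD : s.Dual d r σ) (h : s.WF k σ) (hd : IsHMetric k d γ)
    (hγ : 0 < γ) (hr : r = 1 / ((γ : ℝ) * (k : ℝ) ^ 2)) (hs : Step d γ r σ s s') :
    s'.Dual d r σ := by
  have hk := hd.two_le hγ
  have hr0 : 0 < r := by
    rw [hr]
    positivity
  cases hs with
  | arrive hn ht => exact hD.arrive h hd hr0 ht
  | merge u v Q huv hQ =>
    obtain ⟨hu, hv, hne, ht⟩ := huv
    exact hD.merge h hd hr0 hu hv hne (hr ▸ ht) (by omega) hQ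
  | elapse δ hδ harr htight hevent =>
    refine hD.elapse h hr0 hδ (by omega) fun ε h0 hε u v hu hv hne he => ?_
    exact htight ε h0 hε u v ⟨hu, hv, hne, by rw [he, hr]⟩

theorem Dual.of_reachable (hd : IsHMetric k d γ) (hγ : 0 < γ)
    (hr : r = 1 / ((γ : ℝ) * (k : ℝ) ^ 2)) (hs : Reachable d γ r σ s) : s.Dual d r σ := by
  induction hs with
  | refl => exact Dual.init d r σ
  | tail hs hstep ih => exact ih.step (WF.of_reachable (hd.two_le hγ) hs) hd hγ hr hstep

end State

end KMPMD

namespace KMPMD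

variable {χ : Type*} {k γ : ℕ} {d : (Fin k → χ) → ℝ} {r : ℝ}

/-! ### The online property -/

theorem Instance.AgreeUpTo.symm {σ σ' : Instance χ} {τ : ℝ} (h : σ.AgreeUpTo σ' τ) :
    σ'.AgreeUpTo σ τ := by
  refine fun i => ⟨(h i).1.symm, fun h1 h2 => ?_⟩
  obtain ⟨h3, h4⟩ := (h i).1.2 ⟨h1, h2⟩
  obtain ⟨h5, h6⟩ := (h i).2 h3 h4
  exact ⟨h5.symm, h6.symm⟩

theorem Step.time_le {σ : Instance χ} {s s' : State} (hs : Step d γ r σ s s') :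
    s.time ≤ s'.time := by
  cases hs with
  | arrive => exact le_rfl
  | merge => exact le_rfl
  | elapse δ hδ => exact le_add_of_nonneg_right hδ.le

/-- A step reads only the data of arrived requests and the absence of arrivals before its end, all
of it information up to $\tau$. -/
theorem Step.of_agreeUpTo {σ σ' : Instance χ} {τ : ℝ} (h : σ.AgreeUpTo σ' τ) {s s' : State}
    (hwf : s.WF k σ) (hs : Step d γ r σ s s') (hτ : s'.time ≤ τ) : Step d γ r σ' s s' := by
  have hsτ := hs.time_le.trans hτ
  have hpos : ∀ u, u < s.n → σ'.atime u = σ.atime u ∧ σ'.pos u = σ.pos u := fun u hu =>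
    (h u).2 (hu.trans_le hwf.n_le) ((hwf.arrived u hu).trans hsτ)
  have hcross : ∀ t : State, t.n = s.n → ∀ u v,
      t.CrossTight d γ σ u v ↔ t.CrossTight d γ σ' u v := by
    intro t ht u v
    unfold State.CrossTight Instance.edgeCost
    rw [ht]
    refine and_congr_right fun hu => and_congr_right fun hv => ?_
    rw [(hpos u hu).1, (hpos u hu).2, (hpos v hv).1, (hpos v hv).2]
  have harrive : ∀ t : ℝ, t ≤ τ → ∀ i, i < σ.m → σ.atime i = t →
      i < σ'.m ∧ σ'.atime i = t := by
    intro t ht i hi hit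
    have h1 := (h i).1.1 ⟨hi, hit.trans_le ht⟩
    exact ⟨h1.1, ((h i).2 hi (hit.trans_le ht)).1.trans hit⟩
  cases hs with
  | arrive hn ht =>
    obtain ⟨h1, h2⟩ := harrive _ hsτ _ hn ht
    exact Step.arrive s h1 h2
  | merge u v Q huv hQ => exact Step.merge s u v Q ((hcross s rfl u v).1 huv) hQ
  | elapse δ hδ harr htight hevent =>
    refine Step.elapse s δ hδ (fun i hi him => ?_)
      (fun ε h0 hε u v hc => htight ε h0 hε u v ((hcross (s.elapse r ε) rfl u v).2 hc)) ?_
    -- An arrival of `σ'` strictly before the end of the step is visible by time $\tau$, hence is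
    -- also an arrival of `σ`.
    · by_contra! hlt
      have h1 := (h i).1.2 ⟨him, hlt.le.trans hτ⟩
      have h2 := ((h i).2 h1.1 h1.2).1
      have h3 := harr i hi h1.1
      linarith
    · rcases hevent with ⟨h1, h2⟩ | ⟨u, v, hc⟩
      · exact Or.inl (harrive _ hτ _ h1 h2)
      · exact Or.inr ⟨u, v, (hcross (s.elapse r δ) rfl u v).1 hc⟩

theorem Reachable.of_agreeUpTo (hk : 2 ≤ k) {σ σ' : Instance χ} {τ : ℝ}
    (h : σ.AgreeUpTo σ' τ) {s : State} (hs : Reachable d γ r σ s) (hτ : s.time ≤ τ) :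
    Reachable d γ r σ' s := by
  induction hs with
  | refl => exact Relation.ReflTransGen.refl
  | tail hs hstep ih =>
    exact (ih (hstep.time_le.trans hτ)).tail
      (hstep.of_agreeUpTo h (State.WF.of_reachable hk hs) hτ)

theorem isOnline (hk : 2 ≤ k) : IsOnline d γ r := fun _ _ _ h _ hτ =>
  ⟨fun hs => hs.of_agreeUpTo hk h hτ, fun hs => hs.of_agreeUpTo hk h.symm hτ⟩

/-! ### Termination -/

namespace State

variable {σ : Instance χ} {s : State}

/-- An arrival or a tight edge is waiting to be processed. -/
def Eventful (d : (Fin k → χ) → ℝ) (γ : ℕ) (σ : Instance χ) (s : State) : Prop :=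
  (s.n < σ.m ∧ σ.atime s.n = s.time) ∨ ∃ u v, s.CrossTight d γ σ u v

open Classical in
/-- A bound for the number of steps that remain. -/
noncomputable def potential (d : (Fin k → χ) → ℝ) (γ : ℕ) (σ : Instance χ) (s : State) : ℕ :=
  2 * (2 * (σ.m - s.n) + s.active.card) + if s.Eventful d γ σ then 0 else 1

theorem elapse_zero (s : State) (r : ℝ) : s.elapse r 0 = s := by
  cases s
  simp [elapse]

/-- An arrival lowers $2(m-n)$ by 2 and adds at most one active set; a merge removes at least one.
The outer factor 2 absorbs a change of the last term. Time passes only from a state without events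
to one with an event, which lowers that term from 1 to 0. -/
theorem WF.potential_lt {s' : State} (h : s.WF k σ) (hs : Step d γ r σ s s') :
    s'.potential d γ σ < s.potential d γ σ := by
  unfold potential
  cases hs with
  | arrive hn ht =>
    have hact : s.arrive.active.card ≤ s.active.card + 1 := by
      refine (Finset.card_le_card (t := insert {s.n} s.active) ?_).trans
        (Finset.card_insert_le _ _)
      intro S hS
      obtain ⟨u, hu, rfl⟩ := mem_active.1 hS
      rcases Nat.lt_succ_iff_lt_or_eq.1 hu with hu | rfl
      · exact Finset.mem_insert_of_mem (mem_active.2 ⟨u, hu, (if_neg hu.ne).symm⟩)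
      · exact Finset.mem_insert.2 (Or.inl (if_pos rfl))
    have hn' : s.arrive.n = s.n + 1 := rfl
    rw [hn']
    split_ifs <;> omega
  | merge u v Q huv hQ =>
    obtain ⟨hu, hv, hne, -⟩ := huv
    have hn' : (s.merge u v Q).n = s.n := rfl
    have hu' : s.A u ∈ s.active := mem_active.2 ⟨u, hu, rfl⟩
    have hv' : s.A v ∈ s.active.erase (s.A u) :=
      Finset.mem_erase.2 ⟨hne.symm, mem_active.2 ⟨v, hv, rfl⟩⟩
    have h1 := Finset.card_erase_add_one hu'
    have h2 := Finset.card_erase_add_one hv'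
    have hact : (s.merge u v Q).active.card ≤ ((s.active.erase (s.A u)).erase (s.A v)).card + 1 := by
      refine (Finset.card_le_card
        (t := insert (s.A u ∪ s.A v) ((s.active.erase (s.A u)).erase (s.A v))) ?_).trans
        (Finset.card_insert_le _ _)
      intro S hS
      obtain ⟨w, hw, rfl⟩ := mem_active.1 hS
      by_cases hwB : w ∈ s.A u ∪ s.A v
      · rw [WF.merge_A_of_mem hwB]
        exact Finset.mem_insert_self _ _
      · rw [WF.merge_A_of_notMem hwB]
        have hself := h.mem_A w hw
        refine Finset.mem_insert_of_mem (Finset.mem_erase.2 ⟨fun e => hwB ?_,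
          Finset.mem_erase.2 ⟨fun e => hwB ?_, mem_active.2 ⟨w, hw, rfl⟩⟩⟩)
        · exact Finset.mem_union_right _ (e ▸ hself)
        · exact Finset.mem_union_left _ (e ▸ hself)
    rw [hn']
    split_ifs <;> omega
  | elapse δ hδ harr htight hevent =>
    have h1 : (s.elapse r δ).Eventful d γ σ := hevent
    have h2 : ¬ s.Eventful d γ σ := by
      rintro (⟨hn, ht⟩ | ⟨u, v, hc⟩)
      · have := harr s.n le_rfl hn
        linarith
      · have := htight 0 le_rfl hδ u v
        rw [elapse_zero] at this
        exact this hc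
    have hn' : (s.elapse r δ).n = s.n := rfl
    have ha' : (s.elapse r δ).active = s.active := rfl
    rw [if_pos h1, if_neg h2, hn', ha']
    omega

end State

theorem terminates (hk : 2 ≤ k) (σ : Instance χ) : Terminates d γ r σ := by
  rintro ⟨run, h0, hrun⟩
  have hreach : ∀ i, Reachable d γ r σ (run i) := by
    intro i
    induction i with
    | zero => rw [h0]; exact Relation.ReflTransGen.refl
    | succ i ih => exact ih.tail (hrun i)
  have hlt : ∀ i, (run i).potential d γ σ + i ≤ (run 0).potential d γ σ := by
    intro i
    induction i with
    | zero => exact le_rfl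
    | succ i ih =>
      have := (State.WF.of_reachable hk (hreach i)).potential_lt (hrun i)
      omega
  have := hlt ((run 0).potential d γ σ + 1)
  omega

theorem exists_isOutput (hk : 2 ≤ k) (σ : Instance χ) : ∃ P, IsOutput d γ r σ P := by
  have key : ∀ N : ℕ, ∀ s, Reachable d γ r σ s → s.potential d γ σ = N →
      ∃ P, IsOutput d γ r σ P := by
    intro N
    induction N using Nat.strong_induction_on with
    | _ N ih =>
      intro s hs hN
      by_cases hend : ∀ s', ¬ Step d γ r σ s s'
      · exact ⟨_, s, hs, hend, rfl⟩
      · push Not at hend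
        obtain ⟨s', hs'⟩ := hend
        have := (State.WF.of_reachable hk hs).potential_lt hs'
        exact ih _ (hN ▸ this) s' (hs.tail hs') rfl
  exact key _ _ Relation.ReflTransGen.refl rfl

/-! ### Progress -/

namespace State

variable {σ : Instance χ} {s : State}

/-- If an arrival is due in the future, or some edge is approaching its cost, and nothing is to
be processed now, then time can advance to a next event. -/
theorem WF.exists_elapse (h : s.WF k σ) (hD : s.Dual d r σ) (hr0 : 0 < r)
    (hr : r = 1 / ((γ : ℝ) * (k : ℝ) ^ 2)) (hev : ¬ s.Eventful d γ σ)
    (hnext : s.n < σ.m ∨ ∃ u v, u < s.n ∧ v < s.n ∧ s.A u ≠ s.A v ∧ s.A u ∈ s.growing) :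
    ∃ s', Step d γ r σ s s' := by
  unfold Eventful at hev
  push Not at hev
  obtain ⟨hev1, hev2⟩ := hev
  let c : ℕ × ℕ → ℕ := fun e => (s.growing.filter fun S => ¬ (e.1 ∈ S ↔ e.2 ∈ S)).card
  have hload : ∀ u v ε, (s.elapse r ε).load u v = s.load u v + r * ε * (c (u, v) : ℝ) := by
    intro u v ε
    rw [load_eq_ySum, h.ySum_elapse, ← load_eq_ySum]
  let E : Finset (ℕ × ℕ) := (Finset.range s.n ×ˢ Finset.range s.n).filter
    fun e => s.A e.1 ≠ s.A e.2 ∧ 0 < c e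
  let f : ℕ × ℕ → ℝ := fun e => (r * σ.edgeCost d e.1 e.2 - s.load e.1 e.2) / (r * (c e : ℝ))
  -- The candidate waiting times: until each edge with growing load becomes tight, and until the
  -- next arrival. The step lasts for their minimum.
  let T : Finset ℝ := E.image f ∪ if s.n < σ.m then {σ.atime s.n - s.time} else ∅
  have hE : ∀ u v, (u, v) ∈ E ↔ u < s.n ∧ v < s.n ∧ s.A u ≠ s.A v ∧ 0 < c (u, v) := by
    intro u v
    simp [E, and_assoc]
  have hlt : ∀ u v, u < s.n → v < s.n → s.A u ≠ s.A v →
      s.load u v < r * σ.edgeCost d u v := fun u v hu hv hne =>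
    lt_of_le_of_ne (hD.load_le u v hu hv) fun e => hev2 u v ⟨hu, hv, hne, hr ▸ e⟩
  have hrc : ∀ e, 0 < c e → 0 < r * (c e : ℝ) := fun e he => mul_pos hr0 (Nat.cast_pos.2 he)
  have hTpos : ∀ t ∈ T, 0 < t := by
    intro t ht
    rcases Finset.mem_union.1 ht with ht | ht
    · obtain ⟨⟨u, v⟩, he, rfl⟩ := Finset.mem_image.1 ht
      obtain ⟨hu, hv, hne, hc⟩ := (hE u v).1 he
      exact div_pos (sub_pos.2 (hlt u v hu hv hne)) (hrc _ hc)
    · split_ifs at ht with hn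
      · rw [Finset.mem_singleton] at ht
        rw [ht]
        exact sub_pos.2 (lt_of_le_of_ne (h.pending s.n le_rfl hn) (hev1 hn).symm)
      · simp at ht
  have hTne : T.Nonempty := by
    rcases hnext with hn | ⟨u, v, hu, hv, hne, hg⟩
    · refine ⟨σ.atime s.n - s.time, Finset.mem_union_right _ ?_⟩
      rw [if_pos hn]
      exact Finset.mem_singleton_self _
    · refine ⟨f (u, v), Finset.mem_union_left _ (Finset.mem_image_of_mem _ ((hE u v).2
        ⟨hu, hv, hne, Finset.card_pos.2 ⟨s.A u, Finset.mem_filter.2 ⟨hg, ?_⟩⟩⟩))⟩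
      intro hiff
      exact hne (h.A_eq u hu v (hiff.1 (h.mem_A u hu))).symm
  set δ := T.min' hTne with hδ
  have hδT : δ ∈ T := T.min'_mem hTne
  have hmin : ∀ t ∈ T, δ ≤ t := fun t ht => T.min'_le t ht
  refine ⟨_, Step.elapse s δ (hTpos δ hδT) ?_ ?_ ?_⟩
  · intro i hi him
    have hn : s.n < σ.m := hi.trans_lt him
    have h1 := hmin (σ.atime s.n - s.time) (Finset.mem_union_right _ (by
      rw [if_pos hn]
      exact Finset.mem_singleton_self _))
    have h2 := σ.atime_mono s.n i hi him
    linarith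
  · rintro ε h0 hε u v ⟨hu, hv, hne, he⟩
    have hu' : u < s.n := hu
    have hv' : v < s.n := hv
    have hne' : s.A u ≠ s.A v := hne
    have h1 := hlt u v hu' hv' hne'
    rw [← hr, hload] at he
    -- An edge crossed by no growing set has constant load and is not tight now.
    have hc : 0 < c (u, v) := by
      rcases Nat.eq_zero_or_pos (c (u, v)) with h' | h'
      · rw [h', Nat.cast_zero, mul_zero, add_zero] at he
        exact absurd he h1.ne
      · exact h'
    have h2 := hmin (f (u, v)) (Finset.mem_union_left _ (Finset.mem_image_of_mem _
      ((hE u v).2 ⟨hu', hv', hne', hc⟩)))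
    have h3 : f (u, v) = ε := by
      rw [div_eq_iff (hrc _ hc).ne']
      simp only
      linarith
    linarith
  · rcases Finset.mem_union.1 hδT with ht | ht
    · right
      obtain ⟨⟨u, v⟩, he, hfe⟩ := Finset.mem_image.1 ht
      obtain ⟨hu, hv, hne, hc⟩ := (hE u v).1 he
      refine ⟨u, v, hu, hv, hne, ?_⟩
      rw [div_eq_iff (hrc _ hc).ne'] at hfe
      simp only at hfe
      rw [← hr, hload]
      linarith
    · left
      split_ifs at ht with hn
      · rw [Finset.mem_singleton] at ht
        exact ⟨hn, by linarith⟩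
      · simp at ht

/-- When the algorithm stops, all the requests have arrived and are matched. -/
theorem WF.terminal (h : s.WF k σ) (hD : s.Dual d r σ) (hk : 2 ≤ k) (hm : k ∣ σ.m) (hr0 : 0 < r)
    (hr : r = 1 / ((γ : ℝ) * (k : ℝ) ^ 2)) (hend : ∀ s', ¬ Step d γ r σ s s') :
    s.n = σ.m ∧ s.matched = Finset.range s.n := by
  have hev : ¬ s.Eventful d γ σ := by
    rintro (⟨hn, ht⟩ | ⟨u, v, hc⟩)
    · exact hend _ (Step.arrive s hn ht)
    · obtain ⟨Q, hQ⟩ := exists_isGrouping (k := k) (by omega) (s.free (s.A u ∪ s.A v))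
      exact hend _ (Step.merge s u v Q hc hQ)
  have hnext : ¬ _ := fun hnext =>
    (h.exists_elapse hD hr0 hr hev hnext).elim fun s' hs' => hend s' hs'
  push Not at hnext
  obtain ⟨hn, hgrow⟩ := hnext
  have hn : s.n = σ.m := le_antisymm h.n_le hn
  refine ⟨hn, Finset.Subset.antisymm h.matched_subset fun w hw => ?_⟩
  by_contra hwm
  have hwn := Finset.mem_range.1 hw
  have hg : s.A w ∈ s.growing := mem_growing.2 ⟨mem_active.2 ⟨w, hwn, rfl⟩,
    ⟨w, Finset.mem_sdiff.2 ⟨h.mem_A w hwn, hwm⟩⟩⟩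
  -- An edge leaving the growing set `s.A w` would allow time to advance, so this set contains all
  -- $m$ requests, although its size must not be divisible by $k$.
  have hall : s.A w = Finset.range s.n := by
    refine Finset.Subset.antisymm (h.A_subset w hwn) fun v hv => ?_
    have hv' := Finset.mem_range.1 hv
    by_cases hne : s.A w = s.A v
    · rw [hne]
      exact h.mem_A v hv'
    · exact absurd hg (hgrow w v hwn hv' hne)
  refine h.not_dvd_of_mem_growing hg ?_
  rwa [hall, Finset.card_range, hn]

theorem WF.isPerfect (h : s.WF k σ) (hn : s.n = σ.m) (hm : s.matched = Finset.range s.n) :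
    σ.IsPerfect k s.matching where
  card_eq := h.card_eq
  disjoint := h.disjoint
  cover := hn ▸ hm
  arrived := h.matching_arrived

/-! ### The cost of the matching and the optimal cost -/

/-- Weak duality. -/
theorem Dual.le_cost (hD : s.Dual d r σ) (hd : IsHMetric k d γ) (hγ : 0 < γ)
    (hr : r = 1 / ((γ : ℝ) * (k : ℝ) ^ 2)) (hn : s.n = σ.m) {P : Schedule}
    (hP : σ.IsPerfect k P) : (k - 1) * s.ySum (fun _ => True) ≤ σ.cost d P := by
  have hk := hd.two_le hγ
  have hsub : ∀ x ∈ P, ∀ v ∈ x.1, v < s.n := fun x hx v hv => by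
    rw [hn, ← Finset.mem_range, ← hP.cover]
    exact Finset.mem_biUnion.2 ⟨x, hx, hv⟩
  have h1 : ∑ x ∈ P, ∑ e ∈ x.1 ×ˢ x.1, s.load e.1 e.2 ≤ 2 * σ.cost d P := by
    unfold Instance.cost
    rw [Finset.mul_sum]
    refine Finset.sum_le_sum fun x hx => ?_
    rw [Finset.sum_product]
    refine le_trans (Finset.sum_le_sum fun u hu => Finset.sum_le_sum fun v hv => ?_)
      (σ.sum_edgeCost_le hd hγ (hP.card_eq x hx) (hP.arrived x hx))
    rw [← hr]
    exact hD.load_le u v (hsub x hx u hu) (hsub x hx v hv)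
  -- Double counting: $y_S$ is weighted by the number of ordered pairs within groups that $S$
  -- crosses.
  have h2 : ∑ x ∈ P, ∑ e ∈ x.1 ×ˢ x.1, s.load e.1 e.2 =
      ∑ S ∈ (Finset.range s.n).powerset, s.y S *
        ((∑ x ∈ P, ((x.1 ×ˢ x.1).filter fun e => ¬ (e.1 ∈ S ↔ e.2 ∈ S)).card : ℕ) : ℝ) := by
    simp only [State.load, Finset.sum_filter]
    simp_rw [Finset.sum_comm (t := (Finset.range s.n).powerset)]
    refine Finset.sum_congr rfl fun S _ => ?_
    rw [Nat.cast_sum, Finset.mul_sum]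
    refine Finset.sum_congr rfl fun x _ => ?_
    rw [← Finset.sum_filter, Finset.sum_const, nsmul_eq_mul, mul_comm]
  have h3 : 2 * ((k - 1) * s.ySum fun _ => True) ≤
      ∑ S ∈ (Finset.range s.n).powerset, s.y S *
        ((∑ x ∈ P, ((x.1 ×ˢ x.1).filter fun e => ¬ (e.1 ∈ S ↔ e.2 ∈ S)).card : ℕ) : ℝ) := by
    rw [State.ySum, Finset.filter_true, ← mul_assoc, Finset.mul_sum]
    refine Finset.sum_le_sum fun S hS => ?_
    rw [mul_comm]
    by_cases h0 : s.y S = 0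
    · simp [h0]
    refine mul_le_mul_of_nonneg_left ?_ (hD.y_nonneg S)
    obtain ⟨x, hx, hx1, hx2⟩ := hP.exists_split (hn ▸ Finset.mem_powerset.1 hS) (hD.not_dvd S h0)
    have h4 := le_card_crossing x.1 S hx1 hx2
    rw [hP.card_eq x hx] at h4
    have h5 := h4.trans (Finset.single_le_sum
      (f := fun x : Finset ℕ × ℝ =>
        ((x.1 ×ˢ x.1).filter fun e => ¬ (e.1 ∈ S ↔ e.2 ∈ S)).card) (fun _ _ => Nat.zero_le _) hx)
    have h6 : (2 : ℝ) * (k - 1) = ((2 * (k - 1) : ℕ) : ℝ) := by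
      rw [Nat.cast_mul, Nat.cast_sub (by omega), Nat.cast_one, Nat.cast_ofNat]
    rw [h6]
    exact_mod_cast h5
  linarith

/-- The cost of a matching that covers all the requests, in terms of the dual solution. -/
theorem Dual.cost_le (hD : s.Dual d r σ) (h : s.WF k σ) (hd : IsHMetric k d γ) (hr0 : 0 < r)
    (hm : s.matched = Finset.range s.n) :
    r * σ.cost d s.matching ≤
      (2 * s.matching.card * k + (k - 1)) * s.ySum fun _ => True := by
  have hy := hD.y_nonneg
  -- The star is centred at a request `u` whose active set contains the group; the distance
  -- invariant bounds each leg by $2Y/r$.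
  have hdist : ∀ x ∈ s.matching, σ.distCost d x.1 ≤ k * (2 * s.ySum (fun _ => True) / r) := by
    intro x hx
    obtain ⟨u, hu, hsub⟩ := h.subset_A x hx
    refine σ.distCost_le_star hd (h.card_eq x hx) (σ.pos u) fun v hv => ?_
    rw [le_div_iff₀ hr0]
    have h1 := hD.pairDist_le u hu v (hsub hv) u (h.mem_A u hu)
    have h2 := ySum_nonneg hy fun S => v ∈ S
    have h3 := ySum_nonneg hy fun S => u ∈ S
    have h4 : s.ySum (fun S => S ⊆ s.A u) ≤ s.ySum fun _ => True :=
      ySum_mono hy fun _ _ => trivial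
    linarith
  have hsum := Finset.sum_le_card_nsmul _ _ _ hdist
  have hwait : s.waiting σ = ∑ x ∈ s.matching, ∑ v ∈ x.1, (x.2 - σ.atime v) := by
    rw [waiting, free_eq, hm, sdiff_self, Finset.bot_eq_empty, Finset.sum_empty, add_zero]
  have h1 := hD.waiting_le
  rw [hwait] at h1
  have h2 := mul_le_mul_of_nonneg_left hsum hr0.le
  rw [Instance.cost, Finset.sum_add_distrib, mul_add]
  have h3 : r * (s.matching.card • ((k : ℝ) * (2 * s.ySum (fun _ => True) / r))) =
      2 * s.matching.card * k * s.ySum fun _ => True := by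
    rw [nsmul_eq_mul]
    field_simp
  rw [h3] at h2
  linarith

end State

end KMPMD

/-! ### The competitive ratio -/

theorem theorem2 {χ : Type*} {k γ : ℕ} (d : (Fin k → χ) → ℝ)
    (hd : KMPMD.IsHMetric k d γ) (hγ : 0 < γ) (r : ℝ)
    (hr : r = 1 / ((γ : ℝ) * (k : ℝ) ^ 2)) :
    KMPMD.IsOnline d γ r ∧
    ∀ σ : KMPMD.Instance χ, k ∣ σ.m →
      KMPMD.Terminates d γ r σ ∧
      (∃ P : KMPMD.Schedule, KMPMD.IsOutput d γ r σ P) ∧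
      ∀ P : KMPMD.Schedule, KMPMD.IsOutput d γ r σ P →
        σ.IsPerfect k P ∧
        σ.cost d P ≤ (4 * (σ.m : ℝ) * (k : ℝ) + (k : ℝ) ^ 2) * (γ : ℝ) * σ.opt d := by
  have hk := hd.two_le hγ
  refine ⟨KMPMD.isOnline hk, fun σ hm => ⟨KMPMD.terminates hk σ, KMPMD.exists_isOutput hk σ, ?_⟩⟩
  rintro _ ⟨s, hs, hend, rfl⟩
  have hr0 : 0 < r := by
    rw [hr]
    positivity
  have h := KMPMD.State.WF.of_reachable hk hs
  have hD := KMPMD.State.Dual.of_reachable hd hγ hr hs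
  obtain ⟨hn, hmatched⟩ := h.terminal hD hk hm hr0 hr hend
  have hP := h.isPerfect hn hmatched
  refine ⟨hP, ?_⟩
  have hopt : (k - 1) * s.ySum (fun _ => True) ≤ σ.opt d := by
    -- The matching of the algorithm itself shows that the infimum is over a nonempty set.
    refine le_csInf ⟨_, s.matching, hP, rfl⟩ ?_
    rintro _ ⟨P, hP, rfl⟩
    exact hD.le_cost hd hγ hr hn hP
  have hcost := hD.cost_le h hd hr0 hmatched
  have hcard : (s.matching.card : ℝ) * k = σ.m := by exact_mod_cast hP.card_mul
  have hY := KMPMD.State.ySum_nonneg hD.y_nonneg fun _ => True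
  have hc : (0 : ℝ) ≤ s.matching.card := Nat.cast_nonneg _
  generalize s.ySum (fun _ => True) = Y at hopt hcost hY
  generalize (s.matching.card : ℝ) = c at hcost hcard hc
  have hk' : (2 : ℝ) ≤ k := by exact_mod_cast hk
  have hγ' : (0 : ℝ) < γ := by exact_mod_cast hγ
  -- Since $k\le 2(k-1)$, $2ck+(k-1)\le(4c+1)(k-1)$. Division by $r$ then gives the factor $\gamma
  -- k^2$, and $ck=m$.
  have h1 : r * σ.cost d s.matching ≤ (4 * c + 1) * σ.opt d := by
    refine hcost.trans (le_trans ?_ (mul_le_mul_of_nonneg_left hopt (by positivity)))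
    rw [← mul_assoc]
    refine mul_le_mul_of_nonneg_right ?_ hY
    nlinarith [mul_nonneg hc (sub_nonneg.2 hk')]
  rw [hr, one_div, inv_mul_le_iff₀ (by positivity)] at h1
  refine h1.trans (le_of_eq ?_)
  rw [← hcard]
  ring
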